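/- **Setting.** Graphs are finite, simple and undirected, with node features $x(u)\in\mathbb R^{d_x}$ and symmetric edge features $e(u,v)\in\mathbb R^{d_e}$, where $e(u,v)=0$ if $uv$ is not an edge. Fix $K\ge 0$ and put $$h^{(0)}(u,v)=\big(x(u),x(v),e(u,v),p(u,v)\big),\qquad p(u,v)=\big(I,\hat A,\hat A^2,\dots,\hat A^{K-1}\big)[u,v],\quad \hat A=D^{-1}A,$$ with $A$ the adjacency matrix and $D$ the degree matrix (rows of $\hat A$ at isolated nodes are $0$). A *standard 2-FWL GNN* has a number $L$ of layers, functions $\phi^{(l)},\Phi^{(l)},\Psi$ between spaces of real vectors, injective maps $\mathrm{AGG}$ from finite multisets of vectors to vectors, and computes, for all nodes $u,v$, $$h^{(l)}(u,v)=\Phi^{(l)}\Big(h^{(l-1)}(u,v),\mathrm{AGG}\{\!\!\{\phi^{(l)}(h^{(l-1)}(u,t),h^{(l-1)}(t,v)) : t\in \mathcal N(u,v)\}\!\!\}\Big),\quad \mathcal N(u,v)=V,$$ with graph representation $z_G=\Psi(\mathrm{AGG}\{\!\!\{h^{(L)}(u,v):u,v\in V\}\!\!\})$. A *biconnected component* is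 a maximal subgraph on at least three nodes that remains connected after the removal of any single node. A *Co-Sparsified 2-FWL GNN* starts from the same $h^{(0)}$ and uses the same update, with injective $\mathrm{AGG}$, but only for pairs $u,v$ in the same connected component and with $\mathcal N(u,v)$ replaced by $\mathcal N_{\mathrm{sp}}(u,v)$, where $\mathcal N_{\mathrm{sp}}(u,u)$ is the connected component of $u$ and, for $u\ne v$, $\mathcal N_{\mathrm{sp}}(u,v)$ consists of $u$, $v$ and all $t\notin\{u,v\}$ such that $u,t,v$ lie in a common biconnected component. Each connected component $C$ gets $$z_C=\varPhi\big(\mathrm{AGG}\{\!\!\{h^{(L)}(u,u):u\in C\}\!\!\},\ \mathrm{AGG}\{\!\!\{h^{(L)}(u,v):u,v\in C,\ u\ne v\}\!\!\}\big),$$ and $z_G=z_C$ if $G$ is connected with single component $C$, while otherwise $z_G=\Psi(\mathrm{AGG}\{\!\!\{z_C: C \text{ a connected component of } G\}\!\!\})$. A model *detects* a finite graph $Q$ on a class $\mathcal G$ of graphs if $z_G\neq z_H$ whenever $G,H\in\mathcal G$, $G$ contains $Q$ as a (not necessarily induced) subgraph and $H$ does not. It *distinguishes* $G$ and $H$ if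 $z_G\ne z_H$. The initialization is *consistent* on $\mathcal G$ if, for all pairs of nodes of graphs in $\mathcal G$, the value $h^{(0)}(u,v)$ determines whether $u=v$ and whether $uv$ is an edge. (This always holds for $K\ge2$, and for $K=1$ if all edges have non-zero features.) **Theorem.** Let $\mathcal G$ be a class of graphs with a common upper bound on the number of nodes, and assume that the initialization is consistent on $\mathcal G$. 1. For every finite graph $Q$, some Co-Sparsified 2-FWL GNN detects $Q$ on $\mathcal G$ if and only if some standard 2-FWL GNN detects $Q$ on $\mathcal G$. 2. For all $G,H\in\mathcal G$, in particular for non-isomorphic ones, some Co-Sparsified 2-FWL GNN distinguishes $G$ and $H$ if and only if some standard 2-FWL GNN does. -/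

import Mathlib

/-- Real feature vectors of dimension `d`. -/
abbrev Vec (d : ℕ) : Type := Fin d → ℝ

/-- A finite undirected graph with node features in `ℝ^dx` and (symmetric) edge features in
`ℝ^de`, where the edge feature is zero if there is no edge. -/
structure AttrGraph (dx de : ℕ) where
  V : Type
  [fintypeV : Fintype V]
  graph : SimpleGraph V
  x : V → Vec dx
  e : V → V → Vec de
  e_symm : ∀ u v, e u v = e v u
  e_zero : ∀ u v, ¬ graph.Adj u v → e u v = 0

attribute [instance] AttrGraph.fintypeV

section Connectivity

variable {V : Type}

/-- The subgraph on `B` has at least three nodes and remains connected after removing any single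
node. (With at least three nodes, this forces it to be connected itself.) -/
def IsBiconnected (G : SimpleGraph V) (B : Set V) : Prop :=
  3 ≤ B.ncard ∧ ∀ c ∈ B, (G.induce (B \ {c})).Connected

/-- A biconnected component, given by its node set. A maximal biconnected subgraph is induced, so
it is the same to maximize over node sets. -/
def IsBlock (G : SimpleGraph V) (B : Set V) : Prop :=
  Maximal (IsBiconnected G) B

/-- `((u,t),(t,v))` belongs to the co-sparsified neighbor set of `(u,v)`. The set is empty if `u`
and `v` lie in different connected components. For a self-pair `u = v` it consists of
`((u,u),(u,u))` and all `((u,t),(t,u))` with `t ≠ u` in the component of `u`. For `u ≠ v` it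
consists of the 2-node interactions `((u,u),(u,v))`, `((u,v),(v,v))` and the 3-node interactions
with `u`, `t`, `v` distinct and in a common biconnected component. -/
def SpInteraction (G : SimpleGraph V) (u t v : V) : Prop :=
  G.Reachable u v ∧
    ((u = v ∧ G.Reachable u t) ∨
     (u ≠ v ∧ (t = u ∨ t = v ∨
       (t ≠ u ∧ t ≠ v ∧ ∃ B : Set V, IsBlock G B ∧ u ∈ B ∧ t ∈ B ∧ v ∈ B))))

open Classical in
/-- The co-sparsified neighbor set of `(u,v)`, as the set of its intermediate nodes `t`. -/
noncomputable def spNbr [Fintype V] (G : SimpleGraph V) (u v : V) : Finset V :=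
  Finset.univ.filter fun t => SpInteraction G u t v

open Classical in
/-- The random walk matrix `D⁻¹ A` (with zero rows at isolated nodes). -/
noncomputable def randomWalk [Fintype V] (G : SimpleGraph V) : Matrix V V ℝ :=
  Matrix.diagonal (fun v => (G.degree v : ℝ)⁻¹) * G.adjMatrix ℝ

open Classical in
/-- Relative random walk probabilities: the entries at `(u,v)` of the first `K` powers
`I, D⁻¹A, (D⁻¹A)², …`. -/
noncomputable def rrwp [Fintype V] (G : SimpleGraph V) (K : ℕ) (u v : V) : Vec K :=
  fun k => (randomWalk G ^ (k : ℕ)) u v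

end Connectivity

/-- The space of initial representations `(x(u), x(v), e(u,v), p(u,v))`. -/
abbrev InitRep (dx de K : ℕ) : Type := Vec dx × Vec dx × Vec de × Vec K

/-- The initial representation of a pair of nodes, shared by both kinds of model. -/
noncomputable def initRep {dx de : ℕ} (K : ℕ) (G : AttrGraph dx de) (u v : G.V) :
    InitRep dx de K :=
  (G.x u, G.x v, G.e u v, rrwp G.graph K u v)

/-- Across the graphs of the class, the initial representation of a pair determines whether it is
a self-pair and whether it is an edge. -/
def ConsistentInit {dx de : ℕ} (K : ℕ) (𝒢 : Set (AttrGraph dx de)) : Prop :=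
  ∀ G ∈ 𝒢, ∀ H ∈ 𝒢, ∀ (u v : G.V) (u' v' : H.V), initRep K G u v = initRep K H u' v' →
    ((u = v ↔ u' = v') ∧ (G.graph.Adj u v ↔ H.graph.Adj u' v'))

/-- The space of layer-`l` pair representations: the initial ones for `l = 0`, then real vectors
whose dimension may depend on the layer. -/
def PairRep (I : Type) (width : ℕ → ℕ) : ℕ → Type
  | 0 => I
  | l + 1 => Vec (width l)

/-- The message passing part of a model: number of layers, message functions `φ`, injective
aggregations `AGG` and update functions `Φ`. Index `l` gives the map from layer `l` to layer
`l + 1`; only the indices below `depth` are used. -/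
structure MessagePassing (I : Type) where
  depth : ℕ
  width : ℕ → ℕ
  msgDim : ℕ → ℕ
  aggDim : ℕ → ℕ
  φ : ∀ l, PairRep I width l → PairRep I width l → Vec (msgDim l)
  agg : ∀ l, Multiset (Vec (msgDim l)) → Vec (aggDim l)
  agg_injective : ∀ l, Function.Injective (agg l)
  Φ : ∀ l, PairRep I width l → Vec (aggDim l) → Vec (width l)

namespace MessagePassing

variable {I V : Type} [Fintype V]

/-- Standard 2-FWL message passing: every pair aggregates over all intermediate nodes. -/
def stdRep (M : MessagePassing I) (h₀ : V → V → I) : (l : ℕ) → V → V → PairRep I M.width l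
  | 0 => h₀
  | l + 1 => fun u v =>
      M.Φ l (M.stdRep h₀ l u v)
        (M.agg l ((Finset.univ : Finset V).val.map fun t =>
          M.φ l (M.stdRep h₀ l u t) (M.stdRep h₀ l t v)))

open Classical in
/-- Co-sparsified message passing: a pair in one connected component aggregates over its
co-sparsified neighbor set. Pairs in different components are not updated; the value `0` stored
for them in layers `l ≥ 1` is never read, by a message into a connected pair or by a readout. -/
noncomputable def spRep (M : MessagePassing I) (G : SimpleGraph V) (h₀ : V → V → I) :
    (l : ℕ) → V → V → PairRep I M.width l
  | 0 => h₀
  | l + 1 => fun u v =>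
      if G.Reachable u v then
        M.Φ l (M.spRep G h₀ l u v)
          (M.agg l ((spNbr G u v).val.map fun t =>
            M.φ l (M.spRep G h₀ l u t) (M.spRep G h₀ l t v)))
      else (0 : Vec (M.width l))

end MessagePassing

/-- A standard 2-FWL GNN with its graph-level readout over all node pairs. -/
structure StandardGNN (dx de K : ℕ) extends MessagePassing (InitRep dx de K) where
  readDim : ℕ
  outDim : ℕ
  readAgg : Multiset (PairRep (InitRep dx de K) width depth) → Vec readDim
  readAgg_injective : Function.Injective readAgg
  Ψ : Vec readDim → Vec outDim

/-- The graph representation `z_G = Ψ(AGG {{ h(u,v) | u, v ∈ V }})`. -/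
noncomputable def StandardGNN.out {dx de K : ℕ} (M : StandardGNN dx de K)
    (G : AttrGraph dx de) : Vec M.outDim :=
  M.Ψ (M.readAgg ((Finset.univ : Finset (G.V × G.V)).val.map fun p =>
    M.stdRep (initRep K G) M.depth p.1 p.2))

/-- A Co-Sparsified 2-FWL GNN with its component-level and graph-level readouts. -/
structure CoSparsifiedGNN (dx de K : ℕ) extends MessagePassing (InitRep dx de K) where
  pairDim : ℕ
  compDim : ℕ
  outDim : ℕ
  pairAgg : Multiset (PairRep (InitRep dx de K) width depth) → Vec pairDim
  pairAgg_injective : Function.Injective pairAgg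
  compOut : Vec pairDim → Vec pairDim → Vec outDim
  compAgg : Multiset (Vec outDim) → Vec compDim
  compAgg_injective : Function.Injective compAgg
  Ψ : Vec compDim → Vec outDim

namespace CoSparsifiedGNN

variable {dx de K : ℕ}

open Classical in
/-- The representation `z_C` of a connected component `C`: two parallel readouts, over the
self-pairs and over the off-diagonal pairs of `C`. -/
noncomputable def compRep (M : CoSparsifiedGNN dx de K) (G : AttrGraph dx de)
    (C : G.graph.ConnectedComponent) : Vec M.outDim :=
  M.compOut
    (M.pairAgg (((Finset.univ : Finset G.V).filter fun u => u ∈ C.supp).val.map fun u =>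
      M.spRep G.graph (initRep K G) M.depth u u))
    (M.pairAgg (((Finset.univ : Finset (G.V × G.V)).filter fun p =>
        p.1 ∈ C.supp ∧ p.2 ∈ C.supp ∧ p.1 ≠ p.2).val.map fun p =>
      M.spRep G.graph (initRep K G) M.depth p.1 p.2))

open Classical in
/-- The graph representation: `z_C` if `G` is connected with single component `C`, and otherwise
`Ψ(AGG {{ z_C | C a connected component of G }})`. -/
noncomputable def out (M : CoSparsifiedGNN dx de K) (G : AttrGraph dx de) : Vec M.outDim :=
  if h : G.graph.Connected then
    M.compRep G (G.graph.connectedComponentMk h.nonempty.some)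
  else
    M.Ψ (M.compAgg
      ((Finset.univ.image G.graph.connectedComponentMk).val.map fun C => M.compRep G C))

end CoSparsifiedGNN

/-- The graph representation `z` detects `Q` on the class `𝒢`: it differs between any graph of the
class that contains `Q` as a (not necessarily induced) subgraph and any that does not. -/
def Detects {dx de : ℕ} {α : Type} {W : Type*} (z : AttrGraph dx de → α) (Q : SimpleGraph W)
    (𝒢 : Set (AttrGraph dx de)) : Prop :=
  ∀ G ∈ 𝒢, ∀ H ∈ 𝒢, Q.IsContained G.graph → ¬ Q.IsContained H.graph → z G ≠ z H

/-! Each architecture has a universal model. All representation spaces have at most continuum many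
elements, so every map in a model can be chosen injective. For two graphs with at most `N` nodes,
equality of pair colours across them no longer changes after `N ^ 4` layers. Both claims then reduce
to comparing stable colourings: graphs that the universal model of one kind fails to separate are
separated by no model of the other kind.

Blocks enter through separation. Within a component, `w` separates `u` from `v` when `¬
G.ConnAvoiding w u v`; the endpoints count as separators. Three distinct nodes share a block iff
they are pairwise `Unsep` (`exists_isBlock_iff`).

From standard to sparse: stable 2-FWL colours determine walk counts, and a first-passage
decomposition turns these into counts of walks that avoid a given node. The colours of the pairs
among `u`, `t`, `v` therefore decide `SpInteraction`, and by induction they determine every sparse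
layer (`FullBisim.spRep_eq`).

From sparse to standard: in a component, `u` and `v` are joined by a canonical sequence of
separators whose consecutive members are unseparated. The list of stable sparse colours along it
(`colorChain`), together with the colours of the ends, is stable under full 2-FWL refinement
(`chainColor_stable`): vertices are sorted along the tree of blocks and cut vertices, and each
branch is determined by the colour of the pair at its root. These data also determine the initial
representation (`SparseBisim.initRep_eq`), the random walk part by first passage through the first
separator. So standard colours are functions of chain colours. Chains must be readable in both
directions; this rests on reversibility of the random walk. -/

namespace SimpleGraph

/-! ### Separating vertices and their order along walks. -/

section Separation

variable {V : Type} {G : SimpleGraph V} {r s t u v w x : V}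

/-- Some walk from `u` to `v` avoids the vertex `w`. -/
def ConnAvoiding (G : SimpleGraph V) (w u v : V) : Prop :=
  ∃ p : G.Walk u v, w ∉ p.support

/-- Two distinct vertices of one component that no third vertex separates. -/
def Unsep (G : SimpleGraph V) (u v : V) : Prop :=
  u ≠ v ∧ G.Reachable u v ∧ ∀ s, s ≠ u → s ≠ v → G.ConnAvoiding s u v

namespace ConnAvoiding

theorem ne_left (h : G.ConnAvoiding w u v) : w ≠ u := by
  obtain ⟨p, hp⟩ := h
  rintro rfl
  exact hp p.start_mem_support

theorem ne_right (h : G.ConnAvoiding w u v) : w ≠ v := by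
  obtain ⟨p, hp⟩ := h
  rintro rfl
  exact hp p.end_mem_support

theorem reachable (h : G.ConnAvoiding w u v) : G.Reachable u v := ⟨h.choose⟩

theorem refl (h : w ≠ u) : G.ConnAvoiding w u u := ⟨.nil, by simpa using h⟩

theorem symm (h : G.ConnAvoiding w u v) : G.ConnAvoiding w v u := by
  obtain ⟨p, hp⟩ := h
  exact ⟨p.reverse, by simpa using hp⟩

theorem trans (h : G.ConnAvoiding w u v) (h' : G.ConnAvoiding w v x) :
    G.ConnAvoiding w u x := by
  obtain ⟨p, hp⟩ := h
  obtain ⟨q, hq⟩ := h'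
  exact ⟨p.append q, by simp [Walk.mem_support_append_iff, hp, hq]⟩

theorem of_adj (h : G.Adj u v) (hu : w ≠ u) (hv : w ≠ v) : G.ConnAvoiding w u v :=
  ⟨h.toWalk, by simp [hu, hv]⟩

end ConnAvoiding

theorem connAvoiding_comm : G.ConnAvoiding w u v ↔ G.ConnAvoiding w v u :=
  ⟨.symm, .symm⟩

/-- Of two distinct vertices, one can be reached without passing through the other. -/
theorem Reachable.connAvoiding_or (h : G.Reachable u w) (hne : w ≠ x) :
    G.ConnAvoiding x u w ∨ G.ConnAvoiding w u x := by
  obtain ⟨p⟩ := h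
  induction p with
  | nil => exact .inl (.refl hne.symm)
  | @cons a b c hab p ih =>
    by_cases hx : x = a
    · subst hx; exact .inr (.refl hne)
    by_cases hw : c = a
    · subst hw; exact .inl (.refl hx)
    rcases ih hne with h | h
    · exact .inl ((ConnAvoiding.of_adj hab hx h.ne_left).trans h)
    · exact .inr ((ConnAvoiding.of_adj hab hw h.ne_left).trans h)

/-- From `v`, one of `u` and `x` can be reached without meeting the other, and the separation rules
out that it is `u`. -/
theorem connAvoiding_of_not (h : G.Reachable u v) (hx : x ≠ u) (hs : ¬ G.ConnAvoiding x u v) :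
    G.ConnAvoiding u x v := by
  by_cases hv : x = v
  · subst hv; exact .refl hx.symm
  by_cases hu : u = v
  · subst hu; exact absurd (.refl hx) hs
  rcases h.symm.connAvoiding_or (x := x) hx.symm with h | h
  · exact absurd h.symm hs
  · exact h.symm

/-- From `v`, one of `r` and `s` is reached without the other. Joined to a walk from `u`, the first
case contradicts `h` and the second contradicts `h'`. -/
theorem not_connAvoiding_trans (hs : G.Reachable u s) (hv : G.Reachable u v)
    (h : ¬ G.ConnAvoiding r u s) (h' : ¬ G.ConnAvoiding s u v) : ¬ G.ConnAvoiding r u v := by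
  by_cases hrs : r = s
  · subst hrs; exact h'
  intro hr
  have h1 : G.ConnAvoiding s u r :=
    (hs.connAvoiding_or (x := r) (Ne.symm hrs)).resolve_left h
  rcases (hv.symm.trans hs).connAvoiding_or (x := r) (Ne.symm hrs) with h2 | h2
  · exact h (hr.trans h2)
  · exact h' (h1.trans h2.symm)

theorem Unsep.symm (h : G.Unsep u v) : G.Unsep v u :=
  ⟨h.1.symm, h.2.1.symm, fun s h1 h2 => (h.2.2 s h2 h1).symm⟩

theorem Unsep.ne (h : G.Unsep u v) : u ≠ v := h.1

theorem Unsep.reachable (h : G.Unsep u v) : G.Reachable u v := h.2.1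

theorem Unsep.connAvoiding (h : G.Unsep u v) (hu : s ≠ u) (hv : s ≠ v) :
    G.ConnAvoiding s u v := h.2.2 s hu hv

theorem Unsep.of_adj (h : G.Adj u v) : G.Unsep u v :=
  ⟨h.ne, h.reachable, fun _ => .of_adj h⟩

/-- A separator of `u` and `x` other than `w` would already separate `u` from `w` or `w` from `x`,
so `w` is the only candidate. -/
theorem Unsep.not_unsep_iff (h : G.Unsep u w) (h' : G.Unsep w x) (hx : x ≠ u) :
    ¬ G.Unsep u x ↔ ¬ G.ConnAvoiding w u x := by
  constructor
  · intro hn hw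
    refine hn ⟨hx.symm, h.reachable.trans h'.reachable, fun s hs hs' => ?_⟩
    by_cases hsw : s = w
    · subst hsw; exact hw
    · exact (h.connAvoiding hs hsw).trans (h'.connAvoiding hsw hs')
  · exact fun hn hu => hn (hu.connAvoiding h.ne.symm h'.ne)

/-- A pair has at most one first separator. -/
theorem Unsep.eq_of_separates (h : G.Unsep u w) (h' : G.Unsep u x) (huv : G.Reachable u v)
    (hw : ¬ G.ConnAvoiding w u v) (hx : ¬ G.ConnAvoiding x u v) : w = x := by
  by_contra hne
  rcases (huv.symm.trans h.reachable).connAvoiding_or (x := x) hne with h1 | h1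
  · exact hx ((h.connAvoiding h'.ne.symm (Ne.symm hne)).trans h1.symm)
  · exact hw ((h'.connAvoiding h.ne.symm hne).trans h1.symm)

variable [Fintype V]

open Classical in
/-- The number of vertices that every walk from `u` to `v` meets. -/
noncomputable def sepCount (G : SimpleGraph V) (u v : V) : ℕ :=
  (Finset.univ.filter fun s => ¬ G.ConnAvoiding s u v).card

theorem sepCount_comm : G.sepCount u v = G.sepCount v u := by
  unfold sepCount
  congr! 3
  exact connAvoiding_comm

/-- Supplies the decreasing measure for inductions along chains. Separators are inherited by
`not_connAvoiding_trans`, and `v` is a new one. -/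
theorem sepCount_lt (hs : G.Reachable u s) (hv : G.Reachable u v) (hsv : s ≠ v)
    (h : ¬ G.ConnAvoiding s u v) : G.sepCount u s < G.sepCount u v := by
  classical
  refine Finset.card_lt_card ⟨fun r hr => ?_, fun hsub => ?_⟩
  · simp only [Finset.mem_filter, Finset.mem_univ, true_and] at hr ⊢
    exact not_connAvoiding_trans hs hv hr h
  · have hm := @hsub v (by
      simp only [Finset.mem_filter, Finset.mem_univ, true_and]
      exact fun h => h.ne_right rfl)
    simp only [Finset.mem_filter, Finset.mem_univ, true_and] at hm
    rcases hs.connAvoiding_or (x := v) hsv with h1 | h1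
    · exact hm h1
    · exact h h1

theorem sepCount_lt' (hv : G.Reachable u v) (h : G.Unsep u w) (hs : ¬ G.ConnAvoiding w u v) :
    G.sepCount w v < G.sepCount u v := by
  rw [sepCount_comm, sepCount_comm (u := u)]
  exact sepCount_lt (hv.symm.trans h.reachable) hv.symm h.ne.symm (fun h => hs h.symm)

/-- A pair of distinct vertices of one component has a first separator. -/
theorem Reachable.exists_unsep (hv : G.Reachable u v) (hne : u ≠ v) :
    ∃ w, G.Unsep u w ∧ ¬ G.ConnAvoiding w u v := by
  induction hn : G.sepCount u v using Nat.strong_induction_on generalizing v with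
  | _ n ih =>
    by_cases hN : G.Unsep u v
    · exact ⟨v, hN, fun h => h.ne_right rfl⟩
    · have : ∃ s, s ≠ u ∧ s ≠ v ∧ ¬ G.ConnAvoiding s u v := by
        by_contra! hcon
        exact hN ⟨hne, hv, hcon⟩
      obtain ⟨s, hsu, hsv, hs⟩ := this
      have hus : G.Reachable u s := by
        by_contra hr
        obtain ⟨p⟩ := hv
        refine hs ⟨p, fun hm => hr ?_⟩
        classical exact ⟨p.takeUntil s hm⟩
      obtain ⟨w, hw, hw'⟩ := ih _ (hn ▸ sepCount_lt hus hv hsv hs) hus hsu.symm rfl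
      exact ⟨w, hw, not_connAvoiding_trans hus hv hw' hs⟩

end Separation

/-! ### Biconnected components as maximal sets of pairwise unseparated vertices. -/

section Blocks

variable {V : Type} {G : SimpleGraph V} {t u v : V}

theorem unsep_of_isBiconnected {B : Set V} (hB : IsBiconnected G B) (hu : u ∈ B) (hv : v ∈ B)
    (hne : u ≠ v) : G.Unsep u v := by
  -- Removing `c` leaves a walk inside `B \ {c}`, which avoids `c` and everything outside `B` at
  -- once.
  have key : ∀ c ∈ B, c ≠ u → c ≠ v → ∀ s, (s = c ∨ s ∉ B) → G.ConnAvoiding s u v := by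
    intro c hc hcu hcv s hs
    obtain ⟨p⟩ := (hB.2 c hc).preconnected ⟨u, hu, by simpa using hcu.symm⟩
      ⟨v, hv, by simpa using hcv.symm⟩
    refine ⟨p.map (Embedding.induce (G := G) (B \ {c})).toHom, fun hm => ?_⟩
    obtain ⟨⟨y, hy, hyc⟩, -, rfl⟩ :=
      List.mem_map.1 ((congrArg (s ∈ ·) (Walk.support_map _ p)).mp hm)
    rcases hs with hs | hs
    · exact hyc hs
    · exact hs hy
  -- A third vertex of `B` is needed to deal with separators outside `B`.
  obtain ⟨c, hc, hcuv⟩ : ∃ c ∈ B, c ∉ ({u, v} : Set V) := by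
    refine Set.exists_mem_notMem_of_ncard_lt_ncard ?_
    rw [Set.ncard_pair hne]
    exact hB.1
  simp only [Set.mem_insert_iff, Set.mem_singleton_iff, not_or] at hcuv
  refine ⟨hne, (key c hc hcuv.1 hcuv.2 c (.inl rfl)).reachable, fun s hsu hsv => ?_⟩
  by_cases hs : s ∈ B
  · exact key s hs hsu hsv s (.inl rfl)
  · exact key c hc hcuv.1 hcuv.2 s (.inr hs)

/-- A maximal set of pairwise unseparated vertices contains the paths between its members. -/
theorem mem_of_mem_path {B : Set V} (hB : Maximal (fun B : Set V => B.Pairwise G.Unsep) B)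
    (hu : u ∈ B) (hv : v ∈ B) (p : G.Walk u v) (hp : p.IsPath) (ht : t ∈ p.support) : t ∈ B := by
  classical
  by_contra htB
  have hex : ∃ s ∈ B, ¬ G.Unsep s t := by
    by_contra! hcon
    refine htB (hB.2 (y := insert t B) ?_ (Set.subset_insert _ _) (Set.mem_insert _ _))
    refine hB.1.insert fun b hb hne => ⟨(hcon b hb).symm, hcon b hb⟩
  obtain ⟨s, hs, hst⟩ := hex
  have hreach : G.Reachable s t := by
    have h1 : G.Reachable u t := ⟨p.takeUntil t ht⟩
    by_cases hsu : s = u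
    · subst hsu; exact h1
    · exact (hB.1 hs hu hsu).reachable.trans h1
  have : ∃ w, w ≠ s ∧ w ≠ t ∧ ¬ G.ConnAvoiding w s t := by
    by_contra! hcon
    exact hst ⟨fun h => htB (h ▸ hs), hreach, hcon⟩
  obtain ⟨w, hws, hwt, hw⟩ := this
  -- Members of `B` are unseparated, so `w` cuts all of them off from `t`. It then lies on both
  -- halves of the path around `t`, where a path cannot repeat it.
  have key : ∀ a ∈ B, ¬ G.ConnAvoiding w a t := by
    intro a ha hat
    by_cases hsa : s = a
    · subst hsa; exact hw hat
    · exact hw (((hB.1 hs ha hsa).connAvoiding hws hat.ne_left).trans hat)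
  have hmem : w ∈ (p.takeUntil t ht).support ∧ w ∈ (p.dropUntil t ht).support := by
    constructor
    · by_contra hcon
      exact key u hu ⟨_, hcon⟩
    · by_contra hcon
      exact key v hv (ConnAvoiding.symm ⟨_, hcon⟩)
  have hnd := hp.support_nodup
  rw [← p.take_spec ht, Walk.support_append, List.nodup_append] at hnd
  have h2 := hmem.2
  rw [← Walk.cons_tail_support] at h2
  rcases List.mem_cons.1 h2 with h2 | h2
  · exact hwt h2
  · exact hnd.2.2 _ hmem.1 _ h2 rfl

variable [Finite V]

theorem exists_maximal_pairwise_unsep {A : Set V} (hA : A.Pairwise G.Unsep) :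
    ∃ B, A ⊆ B ∧ Maximal (fun B : Set V => B.Pairwise G.Unsep) B :=
  Finite.exists_le_maximal (p := fun B : Set V => B.Pairwise G.Unsep) hA

/-- A walk avoiding `c` can be shortened to a path, and paths between members stay in `B` by
`mem_of_mem_path`. -/
theorem isBiconnected_of_maximal {B : Set V}
    (hB : Maximal (fun B : Set V => B.Pairwise G.Unsep) B) (h3 : 3 ≤ B.ncard) :
    IsBiconnected G B := by
  classical
  refine ⟨h3, fun c hc => ?_⟩
  rw [connected_iff]
  constructor
  · rintro ⟨a, ha, hac⟩ ⟨b, hb, hbc⟩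
    have hab : G.ConnAvoiding c a b := by
      have hca : c ≠ a := fun h => hac h.symm
      have hcb : c ≠ b := fun h => hbc h.symm
      by_cases h : a = b
      · subst h; exact .refl hca
      · exact (hB.1 ha hb h).connAvoiding hca hcb
    obtain ⟨p, hp⟩ := hab
    refine ⟨p.bypass.induce (B \ {c}) fun x hx =>
      ⟨mem_of_mem_path hB ha hb _ p.bypass_isPath hx, ?_⟩⟩
    rintro rfl
    exact hp (p.support_bypass_subset_support hx)
  · obtain ⟨a, ha, hac⟩ : ∃ a ∈ B, a ∉ ({c} : Set V) := by
      refine Set.exists_mem_notMem_of_ncard_lt_ncard ?_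
      rw [Set.ncard_singleton]
      omega
    exact ⟨⟨a, ha, hac⟩⟩

/-- Three distinct vertices lie in a common block iff they are pairwise unseparated. -/
theorem exists_isBlock_iff (htu : t ≠ u) (htv : t ≠ v) (huv : u ≠ v) :
    (∃ B : Set V, IsBlock G B ∧ u ∈ B ∧ t ∈ B ∧ v ∈ B) ↔
      G.Unsep u t ∧ G.Unsep t v ∧ G.Unsep u v := by
  constructor
  · rintro ⟨B, hB, hu, ht, hv⟩
    exact ⟨unsep_of_isBiconnected hB.1 hu ht htu.symm, unsep_of_isBiconnected hB.1 ht hv htv,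
      unsep_of_isBiconnected hB.1 hu hv huv⟩
  · rintro ⟨h1, h2, h3⟩
    have hA : ({u, t, v} : Set V).Pairwise G.Unsep := by
      intro a ha b hb hab
      simp only [Set.mem_insert_iff, Set.mem_singleton_iff] at ha hb
      rcases ha with rfl | rfl | rfl <;> rcases hb with rfl | rfl | rfl <;>
        first | exact absurd rfl hab | assumption | exact Unsep.symm (by assumption)
    obtain ⟨B, hAB, hB⟩ := exists_maximal_pairwise_unsep hA
    have hcard : 3 ≤ B.ncard := by
      refine le_trans ?_ (Set.ncard_le_ncard hAB)
      rw [Set.ncard_eq_three.2 ⟨u, t, v, htu.symm, huv, htv, rfl⟩]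
    obtain ⟨B', hBB', hB'⟩ := Finite.exists_le_maximal (isBiconnected_of_maximal hB hcard)
    exact ⟨B', hB', hBB' (hAB (by simp)), hBB' (hAB (by simp)), hBB' (hAB (by simp))⟩

/-- The second vertex of any path from `u` to `v` lies in a maximal unseparated set containing both.
Thus a non-adjacent unseparated pair shows itself by a 3-node interaction. -/
theorem Unsep.exists_of_not_adj (h : G.Unsep u v) (hadj : ¬ G.Adj u v) :
    ∃ t, G.Unsep u t ∧ G.Unsep t v := by
  classical
  have hA : ({u, v} : Set V).Pairwise G.Unsep := by
    intro a ha b hb hab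
    simp only [Set.mem_insert_iff, Set.mem_singleton_iff] at ha hb
    rcases ha with rfl | rfl <;> rcases hb with rfl | rfl <;>
      first | exact absurd rfl hab | assumption | exact Unsep.symm (by assumption)
  obtain ⟨B, hAB, hB⟩ := exists_maximal_pairwise_unsep hA
  obtain ⟨p⟩ := h.reachable
  have hu : u ∈ B := hAB (by simp)
  have hv : v ∈ B := hAB (by simp)
  have key : ∀ t ∈ p.bypass.support, t ∈ B := fun t ht =>
    mem_of_mem_path hB hu hv _ p.bypass_isPath ht
  revert key
  have hpath := p.bypass_isPath
  revert hpath
  cases p.bypass with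
  | nil => exact absurd rfl h.ne
  | @cons _ t _ hut q =>
    intro hpath key
    have ht : t ∈ B := key t (by simp)
    have htv : t ≠ v := by rintro rfl; exact hadj hut
    exact ⟨t, hB.1 hu ht hut.ne, hB.1 ht hv htv⟩

/-- The co-sparsified neighbourhood in terms of separation. -/
theorem spInteraction_iff : SpInteraction G u t v ↔ G.Reachable u v ∧
    ((u = v ∧ G.Reachable u t) ∨
      (u ≠ v ∧ (t = u ∨ t = v ∨ (G.Unsep u t ∧ G.Unsep t v ∧ G.Unsep u v)))) := by
  unfold SpInteraction
  refine and_congr_right fun _ => or_congr_right (and_congr_right fun huv => ?_)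
  by_cases htu : t = u
  · simp [htu]
  by_cases htv : t = v
  · simp [htv]
  simp only [htu, htv, ne_eq, not_false_eq_true, true_and, false_or]
  exact exists_isBlock_iff htu htv huv

theorem _root_.SpInteraction.reachable_left (h : SpInteraction G u t v) : G.Reachable u t := by
  rw [spInteraction_iff] at h
  rcases h with ⟨h, ⟨_, h'⟩ | ⟨_, rfl | rfl | h'⟩⟩
  exacts [h', .refl _, h, h'.1.reachable]

theorem _root_.SpInteraction.reachable_right (h : SpInteraction G u t v) : G.Reachable t v :=
  h.reachable_left.symm.trans h.1

theorem _root_.SpInteraction.symm (h : SpInteraction G u t v) : SpInteraction G v t u := by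
  rw [spInteraction_iff] at h ⊢
  refine ⟨h.1.symm, ?_⟩
  rcases h with ⟨h, ⟨rfl, h1⟩ | ⟨hne, h1⟩⟩
  · exact .inl ⟨rfl, h1⟩
  · refine .inr ⟨hne.symm, ?_⟩
    rcases h1 with h1 | h1 | ⟨h1, h2, h3⟩
    exacts [.inr (.inl h1), .inl h1, .inr (.inr ⟨h2.symm, h1.symm, h3.symm⟩)]

end Blocks

end SimpleGraph

theorem mem_spNbr {V : Type} [Fintype V] {G : SimpleGraph V} {u v t : V} :
    t ∈ spNbr G u v ↔ SpInteraction G u t v := by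
  simp [spNbr]

/-! ### First-passage decomposition of matrix powers. -/

section FirstPassage

open Classical in
/-- The matrix `P` with the row of `w` replaced by zero. -/
noncomputable def Matrix.killRow {V : Type} (P : Matrix V V ℝ) (w : V) : Matrix V V ℝ :=
  fun x y => if x = w then 0 else P x y

variable {V V' : Type} [Fintype V] [Fintype V']

open Classical in
/-- Decomposition of the powers of a matrix by the first passage through `w`. -/
theorem Matrix.pow_apply_eq_killRow_add (P : Matrix V V ℝ) (u v w : V) (k : ℕ) :
    (P ^ k) u v = (P.killRow w ^ k) u v +
      ∑ j ∈ Finset.range k, (P.killRow w ^ j) u w * (P ^ (k - j)) w v := by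
  -- The index `j` is the time of the first visit to `w`. It stays below `k` because `killRow` lets
  -- a walk enter `w`, so an arrival at time `k` is in the first term.
  induction k generalizing v with
  | zero => simp
  | succ k ih =>
    rw [pow_succ, Matrix.mul_apply]
    simp_rw [ih, add_mul, Finset.sum_add_distrib]
    have h1 : ∑ x, (P.killRow w ^ k) u x * P x v =
        (P.killRow w ^ (k + 1)) u v + (P.killRow w ^ k) u w * P w v := by
      rw [pow_succ, Matrix.mul_apply, ← Finset.sum_erase_add _ _ (Finset.mem_univ w),
        ← Finset.sum_erase_add (a := w) _ _ (Finset.mem_univ w)]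
      have : P.killRow w w v = 0 := by simp [Matrix.killRow]
      rw [this, mul_zero, add_zero]
      congr 1
      refine Finset.sum_congr rfl fun x hx => ?_
      simp [Matrix.killRow, Finset.ne_of_mem_erase hx]
    have h2 : ∑ x, (∑ j ∈ Finset.range k, (P.killRow w ^ j) u w * (P ^ (k - j)) w x) * P x v =
        ∑ j ∈ Finset.range k, (P.killRow w ^ j) u w * (P ^ (k + 1 - j)) w v := by
      simp_rw [Finset.sum_mul]
      rw [Finset.sum_comm]
      refine Finset.sum_congr rfl fun j hj => ?_
      have : k + 1 - j = (k - j) + 1 := by have := Finset.mem_range.1 hj; omega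
      rw [this, pow_succ, Matrix.mul_apply, Finset.mul_sum]
      simp_rw [mul_assoc]
    rw [h1, h2, Finset.sum_range_succ]
    simp only [Nat.add_sub_cancel_left, pow_one]
    ring

-- For endpoint `w` the decomposition is a renewal equation, which can be solved recursively for the
-- powers of the killed matrix.
open Classical in
theorem Matrix.killRow_pow_self_congr {P : Matrix V V ℝ} {P' : Matrix V' V' ℝ} {u w : V}
    {u' w' : V'} {n : ℕ} (h : ∀ k < n, (P ^ k) u w = (P' ^ k) u' w')
    (hw : ∀ k < n, (P ^ k) w w = (P' ^ k) w' w') {k : ℕ} (hk : k < n) :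
    (P.killRow w ^ k) u w = (P'.killRow w' ^ k) u' w' := by
  induction k using Nat.strong_induction_on with
  | _ k ih =>
    have h1 := Matrix.pow_apply_eq_killRow_add P u w w k
    have h2 := Matrix.pow_apply_eq_killRow_add P' u' w' w' k
    have h3 : ∑ j ∈ Finset.range k, (P.killRow w ^ j) u w * (P ^ (k - j)) w w =
        ∑ j ∈ Finset.range k, (P'.killRow w' ^ j) u' w' * (P' ^ (k - j)) w' w' := by
      refine Finset.sum_congr rfl fun j hj => ?_
      have hj := Finset.mem_range.1 hj
      rw [ih j hj (by omega), hw (k - j) (by omega)]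
    rw [h k hk] at h1
    linarith

-- Used in both directions: a known power gives the killed power, and a vanishing killed power gives
-- the power itself.
open Classical in
theorem Matrix.pow_sub_killRow_pow_congr {P : Matrix V V ℝ} {P' : Matrix V' V' ℝ} {u v w : V}
    {u' v' w' : V'} {n : ℕ} (h : ∀ k < n, (P ^ k) u w = (P' ^ k) u' w')
    (hw : ∀ k < n, (P ^ k) w w = (P' ^ k) w' w') (hv : ∀ k < n, (P ^ k) w v = (P' ^ k) w' v')
    {k : ℕ} (hk : k < n) :
    (P ^ k) u v - (P.killRow w ^ k) u v = (P' ^ k) u' v' - (P'.killRow w' ^ k) u' v' := by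
  rw [Matrix.pow_apply_eq_killRow_add P u v w k, Matrix.pow_apply_eq_killRow_add P' u' v' w' k,
    add_sub_cancel_left, add_sub_cancel_left]
  refine Finset.sum_congr rfl fun j hj => ?_
  have hj := Finset.mem_range.1 hj
  rw [Matrix.killRow_pow_self_congr h hw (by omega), hv (k - j) (by omega)]

open Classical in
theorem Matrix.reflTransGen_of_pow_ne_zero {P : Matrix V V ℝ} {u v : V} {k : ℕ}
    (h : (P ^ k) u v ≠ 0) : Relation.ReflTransGen (fun x y => P x y ≠ 0) u v := by
  induction k generalizing v with
  | zero =>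
    have : u = v := by
      by_contra hne
      simp [hne] at h
    exact this ▸ .refl
  | succ k ih =>
    rw [pow_succ, Matrix.mul_apply] at h
    obtain ⟨x, -, hx⟩ := Finset.exists_ne_zero_of_sum_ne_zero h
    exact (ih (left_ne_zero_of_mul hx)).tail (right_ne_zero_of_mul hx)

open Classical in
theorem Matrix.exists_pow_ne_zero_iff {P : Matrix V V ℝ} (hP : ∀ x y, 0 ≤ P x y) {u v : V} :
    (∃ k, (P ^ k) u v ≠ 0) ↔ Relation.ReflTransGen (fun x y => P x y ≠ 0) u v := by
  refine ⟨fun ⟨k, hk⟩ => reflTransGen_of_pow_ne_zero hk, fun h => ?_⟩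
  induction h with
  | refl => exact ⟨0, by simp⟩
  | @tail x y _ hxy ih =>
    obtain ⟨k, hk⟩ := ih
    refine ⟨k + 1, ne_of_gt ?_⟩
    rw [pow_succ, Matrix.mul_apply]
    refine Finset.sum_pos' (fun z _ => mul_nonneg (pow_apply_nonneg hP k u z) (hP z y))
      ⟨x, Finset.mem_univ _, mul_pos ?_ ?_⟩
    · exact lt_of_le_of_ne (pow_apply_nonneg hP k u x) hk.symm
    · exact lt_of_le_of_ne (hP x y) hxy.symm

namespace SimpleGraph

variable {G : SimpleGraph V} {u v w : V}

theorem connAvoiding_iff_reflTransGen {V : Type} {G : SimpleGraph V} {u v w : V} (hv : w ≠ v) :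
    G.ConnAvoiding w u v ↔ Relation.ReflTransGen (fun x y => x ≠ w ∧ G.Adj x y) u v := by
  constructor
  · rintro ⟨p, hp⟩
    induction p with
    | nil => exact .refl
    | @cons a b c hab p ih =>
      simp only [Walk.support_cons, List.mem_cons, not_or] at hp
      exact .head ⟨Ne.symm hp.1, hab⟩ (ih hv hp.2)
  · intro h
    induction h using Relation.ReflTransGen.head_induction_on with
    | refl => exact .refl hv
    | head h _ ih => exact (ConnAvoiding.of_adj h.2 h.1.symm ih.ne_left).trans ih

theorem reflTransGen_killRow {V : Type} {G : SimpleGraph V} {u v w : V}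
    {P : Matrix V V ℝ} (hP : ∀ x y, P x y ≠ 0 → G.Adj x y)
    (h : Relation.ReflTransGen (fun x y => P.killRow w x y ≠ 0) u v) (hv : w ≠ v) :
    G.ConnAvoiding w u v := by
  rw [connAvoiding_iff_reflTransGen hv]
  refine Relation.ReflTransGen.mono (fun x y hxy => ?_) _ _ h
  by_cases hx : x = w
  · simp [Matrix.killRow, hx] at hxy
  · simp only [Matrix.killRow, if_neg hx] at hxy
    exact ⟨hx, hP _ _ hxy⟩

open Classical in
theorem killRow_pow_eq_zero {P : Matrix V V ℝ} (hP : ∀ x y, P x y ≠ 0 → G.Adj x y)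
    (h : ¬ G.ConnAvoiding w u v) (hv : w ≠ v) (k : ℕ) : (P.killRow w ^ k) u v = 0 := by
  by_contra hne
  exact h (reflTransGen_killRow hP (Matrix.reflTransGen_of_pow_ne_zero hne) hv)

open Classical in
theorem exists_adjMatrix_pow_ne_zero_iff :
    (∃ k, (G.adjMatrix ℝ ^ k) u v ≠ 0) ↔ G.Reachable u v := by
  rw [Matrix.exists_pow_ne_zero_iff, reachable_iff_reflTransGen]
  · simp [adjMatrix_apply]
  · intro x y
    rw [adjMatrix_apply]
    split_ifs <;> norm_num

-- `killRow` forbids leaving `w` but not arriving there, hence the condition `w ≠ v`.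
open Classical in
theorem exists_killRow_pow_ne_zero_iff (hv : w ≠ v) :
    (∃ k, ((G.adjMatrix ℝ).killRow w ^ k) u v ≠ 0) ↔ G.ConnAvoiding w u v := by
  rw [Matrix.exists_pow_ne_zero_iff, connAvoiding_iff_reflTransGen hv]
  · have : (fun x y => (G.adjMatrix ℝ).killRow w x y ≠ 0) = fun x y => x ≠ w ∧ G.Adj x y := by
      ext x y
      simp [Matrix.killRow, adjMatrix_apply]
    rw [this]
  · intro x y
    rw [Matrix.killRow, adjMatrix_apply]
    split_ifs <;> norm_num

end SimpleGraph

end FirstPassage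

/-! ### Reversibility of the random walk. -/

section RandomWalk

variable {V V' : Type} [Fintype V] [Fintype V']

open Classical in
theorem randomWalk_apply (G : SimpleGraph V) (u v : V) :
    randomWalk G u v = (G.degree u : ℝ)⁻¹ * G.adjMatrix ℝ u v := by
  rw [randomWalk, Matrix.diagonal_mul]

theorem adj_of_randomWalk_ne_zero {G : SimpleGraph V} {u v : V} (h : randomWalk G u v ≠ 0) :
    G.Adj u v := by
  classical
  by_contra hn
  rw [randomWalk_apply] at h
  simp [SimpleGraph.adjMatrix_apply, hn] at h

open Classical in
/-- The random walk is reversible with respect to the degrees. -/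
theorem degree_mul_randomWalk_pow (G : SimpleGraph V) (u v : V) (k : ℕ) :
    (G.degree u : ℝ) * (randomWalk G ^ k) u v = (G.degree v : ℝ) * (randomWalk G ^ k) v u := by
  set D : Matrix V V ℝ := Matrix.diagonal fun v => (G.degree v : ℝ) with hD
  have key : ∀ u v, (G.degree u : ℝ) * randomWalk G u v = G.adjMatrix ℝ u v := by
    intro u v
    rw [randomWalk_apply, ← mul_assoc]
    by_cases h : G.Adj u v
    · have : (G.degree u : ℝ) ≠ 0 := by
        have := (G.degree_pos_iff_exists_adj u).2 ⟨v, h⟩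
        positivity
      rw [mul_inv_cancel₀ this, one_mul]
    · simp [SimpleGraph.adjMatrix_apply, h]
  have hs : SemiconjBy D (randomWalk G) (randomWalk G).transpose := by
    ext u v
    rw [hD, Matrix.diagonal_mul, Matrix.mul_diagonal, Matrix.transpose_apply, key, mul_comm, key]
    simp [SimpleGraph.adjMatrix_apply, G.adj_comm]
  have h := congrFun (congrFun (hs.pow_right k).eq u) v
  rw [hD, Matrix.diagonal_mul, Matrix.mul_diagonal, ← Matrix.transpose_pow,
    Matrix.transpose_apply] at h
  rw [h, mul_comm]

-- Reversing a pair multiplies its entry by a ratio of degrees; the degree at `v` must be non-zero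
-- to cancel it.
open Classical in
theorem randomWalk_pow_symm_congr {G : SimpleGraph V} {G' : SimpleGraph V'} {u v : V} {u' v' : V'}
    {k : ℕ} (hu : G.degree u = G'.degree u') (hv : G.degree v = G'.degree v')
    (hpos : G.degree v ≠ 0) (h : (randomWalk G ^ k) u v = (randomWalk G' ^ k) u' v') :
    (randomWalk G ^ k) v u = (randomWalk G' ^ k) v' u' := by
  have h1 := degree_mul_randomWalk_pow G u v k
  have h2 := degree_mul_randomWalk_pow G' u' v' k
  rw [h, hu, h2, hv] at h1
  have : (G'.degree v' : ℝ) ≠ 0 := by exact_mod_cast hv ▸ hpos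
  exact (mul_left_cancel₀ this h1).symm

end RandomWalk

/-! ### Transfer along equal multisets of colours. -/

section MultisetTransfer

variable {α α' β γ : Type*} {A : Multiset α} {A' : Multiset α'} {f : α → β} {f' : α' → β}

/-- Equal images amount to a matching of `A` with `A'` that preserves colours, and anything
determined by the colour can be transported along it. -/
theorem Multiset.map_congr_of_map_eq (h : A.map f = A'.map f') {g : α → γ} {g' : α' → γ}
    (hg : ∀ a ∈ A, ∀ a' ∈ A', f a = f' a' → g a = g' a') : A.map g = A'.map g' := by
  rw [← Multiset.rel_eq, Multiset.rel_map] at h ⊢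
  exact h.mono hg

theorem Multiset.bind_congr_of_map_eq (h : A.map f = A'.map f') {g : α → Multiset γ}
    {g' : α' → Multiset γ} (hg : ∀ a ∈ A, ∀ a' ∈ A', f a = f' a' → g a = g' a') :
    A.bind g = A'.bind g' :=
  congrArg Multiset.join (Multiset.map_congr_of_map_eq h hg)

theorem Multiset.filter_map_congr_of_map_eq (h : A.map f = A'.map f') {p : α → Prop}
    {p' : α' → Prop} [DecidablePred p] [DecidablePred p']
    (hp : ∀ a ∈ A, ∀ a' ∈ A', f a = f' a' → (p a ↔ p' a')) :
    (A.filter p).map f = (A'.filter p').map f' := by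
  classical
  have h1 := Multiset.map_congr_of_map_eq h (g := fun a => (f a, p a)) (g' := fun a => (f' a, p' a))
    (fun a ha a' ha' e => Prod.ext e (propext (hp a ha a' ha' e)))
  have h2 := congrArg (fun m => (m.filter fun x => x.2).map Prod.fst) h1
  simpa only [Multiset.filter_map, Multiset.map_map, Function.comp_def] using h2

theorem Multiset.exists_of_map_eq (h : A.map f = A'.map f') {a : α} (ha : a ∈ A) :
    ∃ a' ∈ A', f a = f' a' := by
  have := h ▸ Multiset.mem_map_of_mem f ha
  obtain ⟨a', ha', e⟩ := Multiset.mem_map.1 this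
  exact ⟨a', ha', e.symm⟩

end MultisetTransfer

/-- A decreasing sequence of relations between finite types, in which every repetition is
permanent, is constant from the product of the cardinalities on. -/
theorem relation_stabilizes {P Q : Type} [Fintype P] [Fintype Q] (r : ℕ → P → Q → Prop)
    (mono : ∀ l p q, r (l + 1) p q → r l p q)
    (step : ∀ l, (∀ p q, r l p q → r (l + 1) p q) → ∀ p q, r (l + 1) p q → r (l + 2) p q)
    {n : ℕ} (hn : Fintype.card P * Fintype.card Q ≤ n) (p : P) (q : Q) (h : r n p q) :
    r (n + 1) p q := by
  classical
  by_contra hcon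
  have hall : ∀ l ≤ n, ¬ ∀ p q, r l p q → r (l + 1) p q := by
    intro l hl hst
    have : ∀ m, l ≤ m → ∀ p q, r m p q → r (m + 1) p q := by
      intro m hm
      induction m, hm using Nat.le_induction with
      | base => exact hst
      | succ m _ ih => exact step m ih
    exact hcon (this n hl p q h)
  let F : ℕ → Finset (P × Q) := fun l => Finset.univ.filter fun x => r l x.1 x.2
  -- Without a repetition every step loses a pair, and `n + 1` losses are more than there are pairs.
  have hF : ∀ l ≤ n + 1, (F l).card + l ≤ Fintype.card P * Fintype.card Q := by
    intro l hl
    induction l with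
    | zero =>
      rw [← Fintype.card_prod]
      exact Finset.card_le_univ _
    | succ l ih =>
      have hlt : (F (l + 1)).card < (F l).card := by
        have := hall l (by omega)
        push Not at this
        obtain ⟨a, b, hab, hab'⟩ := this
        refine Finset.card_lt_card ⟨fun x hx => ?_, fun hsub => ?_⟩
        · simp only [F, Finset.mem_filter, Finset.mem_univ, true_and] at hx ⊢
          exact mono _ _ _ hx
        · have := @hsub (a, b) (by simpa [F] using hab)
          simp [F, hab'] at this
      have := ih (by omega)
      omega
  have := hF (n + 1) le_rfl
  omega

/-! ### Universal models by cardinality, and stabilization of their colours. -/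

section Universal

open Cardinal

theorem mk_vec_le (d : ℕ) : #(Vec d) ≤ 𝔠 := by
  rw [Vec, ← power_def, mk_real, mk_fin]
  calc 𝔠 ^ (d : Cardinal) ≤ 𝔠 ^ ℵ₀ :=
        power_le_power_left continuum_ne_zero natCast_lt_aleph0.le
    _ = 𝔠 := continuum_power_aleph0

theorem mk_prod_le_continuum {α β : Type} (hα : #α ≤ 𝔠) (hβ : #β ≤ 𝔠) : #(α × β) ≤ 𝔠 := by
  rw [mk_prod, lift_id, lift_id, ← continuum_mul_self]
  exact mul_le_mul' hα hβ

theorem mk_multiset_le_continuum {α : Type} (hα : #α ≤ 𝔠) : #(Multiset α) ≤ 𝔠 :=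
  (mk_le_of_surjective (Quot.mk_surjective (r := List.isSetoid α))).trans
    ((mk_list_le_max α).trans (max_le aleph0_le_continuum hα))

theorem mk_initRep_le (dx de K : ℕ) : #(InitRep dx de K) ≤ 𝔠 :=
  mk_prod_le_continuum (mk_vec_le _) (mk_prod_le_continuum (mk_vec_le _)
    (mk_prod_le_continuum (mk_vec_le _) (mk_vec_le _)))

theorem mk_pairRep_le {I : Type} (hI : #I ≤ 𝔠) (width : ℕ → ℕ) (l : ℕ) :
    #(PairRep I width l) ≤ 𝔠 := by
  cases l with
  | zero => exact hI
  | succ l => exact mk_vec_le _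

/-- The maps of a model carry no regularity assumption, so only cardinality matters and one real
coordinate suffices. -/
theorem exists_injective_vec {α : Type} (h : #α ≤ 𝔠) : ∃ f : α → Vec 1, Function.Injective f := by
  have : #(Vec 1) = 𝔠 := by rw [Vec, ← power_def, mk_real, mk_fin]; simp
  rw [← this] at h
  obtain ⟨f⟩ := h
  exact ⟨f, f.injective⟩

/-- All message and update functions are injective. -/
def MessagePassing.IsInjective {I : Type} (M : MessagePassing I) : Prop :=
  (∀ l, Function.Injective2 (M.φ l)) ∧ ∀ l, Function.Injective2 (M.Φ l)

theorem MessagePassing.exists_isInjective {I : Type} (hI : #I ≤ 𝔠) (L : ℕ) :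
    ∃ M : MessagePassing I, M.depth = L ∧ M.IsInjective := by
  have h1 : ∀ l, ∃ f : PairRep I (fun _ => 1) l × PairRep I (fun _ => 1) l → Vec 1,
      Function.Injective f := fun l => exists_injective_vec
    (mk_prod_le_continuum (mk_pairRep_le hI _ l) (mk_pairRep_le hI _ l))
  have h2 : ∀ l, ∃ f : PairRep I (fun _ => 1) l × Vec 1 → Vec 1,
      Function.Injective f := fun l => exists_injective_vec
    (mk_prod_le_continuum (mk_pairRep_le hI _ l) (mk_vec_le 1))
  obtain ⟨a, ha⟩ := exists_injective_vec (mk_multiset_le_continuum (mk_vec_le 1))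
  choose f hf using h1
  choose g hg using h2
  refine ⟨⟨L, fun _ => 1, fun _ => 1, fun _ => 1, fun l x y => f l (x, y), fun _ => a, fun _ => ha,
    fun l x y => g l (x, y)⟩, rfl, fun l x x' y y' h => ?_, fun l x x' y y' h => ?_⟩
  · exact Prod.ext_iff.1 (hf l h)
  · exact Prod.ext_iff.1 (hg l h)

namespace MessagePassing

variable {I V V' : Type} [Fintype V] [Fintype V'] {M : MessagePassing I}
  {h₀ : V → V → I} {h₀' : V' → V' → I}

/-- With injective maps a layer loses nothing: it is exactly one step of colour refinement. -/
theorem IsInjective.stdRep_succ_eq_iff (hM : M.IsInjective) {l : ℕ} {u v : V} {u' v' : V'} :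
    M.stdRep h₀ (l + 1) u v = M.stdRep h₀' (l + 1) u' v' ↔
      M.stdRep h₀ l u v = M.stdRep h₀' l u' v' ∧
      ((Finset.univ : Finset V).val.map fun t => (M.stdRep h₀ l u t, M.stdRep h₀ l t v)) =
        (Finset.univ : Finset V').val.map fun t => (M.stdRep h₀' l u' t, M.stdRep h₀' l t v') := by
  constructor
  · intro h
    obtain ⟨h1, h2⟩ := hM.2 l h
    refine ⟨h1, Multiset.map_congr_of_map_eq (M.agg_injective l h2) fun t _ t' _ e => ?_⟩
    exact Prod.ext_iff.2 (hM.1 l e)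
  · rintro ⟨h1, h2⟩
    refine congrArg₂ (M.Φ l) h1 (congrArg (M.agg l) ?_)
    refine Multiset.map_congr_of_map_eq h2 fun t _ t' _ e => ?_
    exact congrArg₂ (M.φ l) (congrArg Prod.fst e) (congrArg Prod.snd e)

theorem spRep_succ_of_reachable {G : SimpleGraph V} {u v : V} (h : G.Reachable u v) (l : ℕ) :
    M.spRep G h₀ (l + 1) u v = M.Φ l (M.spRep G h₀ l u v)
      (M.agg l ((spNbr G u v).val.map fun t =>
        M.φ l (M.spRep G h₀ l u t) (M.spRep G h₀ l t v))) :=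
  if_pos h

theorem IsInjective.spRep_succ_eq_iff (hM : M.IsInjective) {G : SimpleGraph V}
    {G' : SimpleGraph V'} {l : ℕ} {u v : V} {u' v' : V'} (h : G.Reachable u v)
    (h' : G'.Reachable u' v') :
    M.spRep G h₀ (l + 1) u v = M.spRep G' h₀' (l + 1) u' v' ↔
      M.spRep G h₀ l u v = M.spRep G' h₀' l u' v' ∧
      ((spNbr G u v).val.map fun t => (M.spRep G h₀ l u t, M.spRep G h₀ l t v)) =
        (spNbr G' u' v').val.map fun t => (M.spRep G' h₀' l u' t, M.spRep G' h₀' l t v') := by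
  rw [spRep_succ_of_reachable h, spRep_succ_of_reachable h']
  constructor
  · intro h
    obtain ⟨h1, h2⟩ := hM.2 l h
    refine ⟨h1, Multiset.map_congr_of_map_eq (M.agg_injective l h2) fun t _ t' _ e => ?_⟩
    exact Prod.ext_iff.2 (hM.1 l e)
  · rintro ⟨h1, h2⟩
    refine congrArg₂ (M.Φ l) h1 (congrArg (M.agg l) ?_)
    refine Multiset.map_congr_of_map_eq h2 fun t _ t' _ e => ?_
    exact congrArg₂ (M.φ l) (congrArg Prod.fst e) (congrArg Prod.snd e)

theorem IsInjective.stdRep_zero_of_eq (hM : M.IsInjective) {l : ℕ} {u v : V} {u' v' : V'}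
    (h : M.stdRep h₀ l u v = M.stdRep h₀' l u' v') : h₀ u v = h₀' u' v' := by
  induction l with
  | zero => exact h
  | succ l ih => exact ih (hM.stdRep_succ_eq_iff.1 h).1

theorem IsInjective.spRep_zero_of_eq (hM : M.IsInjective) {G : SimpleGraph V}
    {G' : SimpleGraph V'} {l : ℕ} {u v : V} {u' v' : V'} (hr : G.Reachable u v)
    (hr' : G'.Reachable u' v') (h : M.spRep G h₀ l u v = M.spRep G' h₀' l u' v') :
    h₀ u v = h₀' u' v' := by
  induction l with
  | zero => exact h
  | succ l ih => exact ih ((hM.spRep_succ_eq_iff hr hr').1 h).1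

theorem IsInjective.stdRep_stable (hM : M.IsInjective) {n : ℕ}
    (hn : Fintype.card (V × V) * Fintype.card (V' × V') ≤ n) {u v : V} {u' v' : V'}
    (h : M.stdRep h₀ n u v = M.stdRep h₀' n u' v') :
    ((Finset.univ : Finset V).val.map fun t => (M.stdRep h₀ n u t, M.stdRep h₀ n t v)) =
      (Finset.univ : Finset V').val.map fun t => (M.stdRep h₀' n u' t, M.stdRep h₀' n t v') := by
  refine (hM.stdRep_succ_eq_iff.1 (relation_stabilizes (fun l (p : V × V) (q : V' × V') =>
    M.stdRep h₀ l p.1 p.2 = M.stdRep h₀' l q.1 q.2) (fun l p q h => (hM.stdRep_succ_eq_iff.1 h).1)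
    (fun l hl p q h => ?_) hn (u, v) (u', v') h)).2
  refine hM.stdRep_succ_eq_iff.2 ⟨h, ?_⟩
  refine Multiset.map_congr_of_map_eq (hM.stdRep_succ_eq_iff.1 h).2 fun t _ t' _ e => ?_
  exact Prod.ext (hl (_, t) (_, t') (congrArg Prod.fst e)) (hl (t, _) (t', _) (congrArg Prod.snd e))

theorem IsInjective.spRep_stable (hM : M.IsInjective) {G : SimpleGraph V} {G' : SimpleGraph V'}
    {n : ℕ} (hn : Fintype.card (V × V) * Fintype.card (V' × V') ≤ n) {u v : V} {u' v' : V'}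
    (hr : G.Reachable u v) (hr' : G'.Reachable u' v')
    (h : M.spRep G h₀ n u v = M.spRep G' h₀' n u' v') :
    ((spNbr G u v).val.map fun t => (M.spRep G h₀ n u t, M.spRep G h₀ n t v)) =
      (spNbr G' u' v').val.map fun t => (M.spRep G' h₀' n u' t, M.spRep G' h₀' n t v') := by
  refine ((hM.spRep_succ_eq_iff hr hr').1 (relation_stabilizes
    (fun l (p : V × V) (q : V' × V') => G.Reachable p.1 p.2 ∧ G'.Reachable q.1 q.2 ∧
      M.spRep G h₀ l p.1 p.2 = M.spRep G' h₀' l q.1 q.2)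
    (fun l p q h => ⟨h.1, h.2.1, ((hM.spRep_succ_eq_iff h.1 h.2.1).1 h.2.2).1⟩)
    (fun l hl p q h => ?_) hn (u, v) (u', v') ⟨hr, hr', h⟩).2.2).2
  obtain ⟨h1, h2, h3⟩ := h
  refine ⟨h1, h2, (hM.spRep_succ_eq_iff h1 h2).2 ⟨h3, ?_⟩⟩
  refine Multiset.map_congr_of_map_eq ((hM.spRep_succ_eq_iff h1 h2).1 h3).2 fun t ht t' ht' e => ?_
  have ht : SpInteraction G _ t _ := mem_spNbr.1 ht
  have ht' : SpInteraction G' _ t' _ := mem_spNbr.1 ht'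
  exact Prod.ext
    (hl (_, t) (_, t') ⟨ht.reachable_left, ht'.reachable_left, congrArg Prod.fst e⟩).2.2
    (hl (t, _) (t', _) ⟨ht.reachable_right, ht'.reachable_right, congrArg Prod.snd e⟩).2.2

end MessagePassing

theorem StandardGNN.exists_isInjective (dx de K L : ℕ) :
    ∃ U : StandardGNN dx de K, U.depth = L ∧ U.IsInjective ∧ Function.Injective U.Ψ := by
  obtain ⟨M, rfl, hM⟩ := MessagePassing.exists_isInjective (mk_initRep_le dx de K) L
  obtain ⟨a, ha⟩ := exists_injective_vec
    (mk_multiset_le_continuum (mk_pairRep_le (mk_initRep_le dx de K) M.width M.depth))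
  exact ⟨⟨M, 1, 1, a, ha, id⟩, rfl, hM, Function.injective_id⟩

theorem CoSparsifiedGNN.exists_isInjective (dx de K L : ℕ) :
    ∃ U : CoSparsifiedGNN dx de K, U.depth = L ∧ U.IsInjective ∧ Function.Injective2 U.compOut ∧
      Function.Injective U.Ψ ∧ ∀ a b y, U.compOut a b ≠ U.Ψ y := by
  obtain ⟨M, rfl, hM⟩ := MessagePassing.exists_isInjective (mk_initRep_le dx de K) L
  obtain ⟨a, ha⟩ := exists_injective_vec
    (mk_multiset_le_continuum (mk_pairRep_le (mk_initRep_le dx de K) M.width M.depth))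
  obtain ⟨b, hb⟩ := exists_injective_vec (mk_multiset_le_continuum (mk_vec_le 2))
  obtain ⟨f, hf⟩ := exists_injective_vec (mk_prod_le_continuum (mk_vec_le 1) (mk_vec_le 1))
  -- The first output coordinate is a tag: `0` for a component, `1` for a disconnected graph.
  refine ⟨⟨M, 1, 1, 2, a, ha, fun x y => ![0, f (x, y) 0], b, hb, fun y => ![1, y 0]⟩, rfl, hM,
    fun x x' y y' h => ?_, fun y y' h => ?_, fun x x' y h => ?_⟩
  · refine Prod.ext_iff.1 (@hf (x, y) (x', y') (funext fun i => ?_))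
    have h := congrFun h 1
    rw [Subsingleton.elim i 0]
    simpa using h
  · funext i
    have h := congrFun h 1
    rw [Subsingleton.elim i 0]
    simpa using h
  · have h := congrFun h 0
    simp at h

end Universal

/-! ### Stable 2-FWL colours determine the sparse neighbourhoods. -/

section FullStability

variable {V V' X : Type} [Fintype V] [Fintype V']

/-- Equality of the colors `c` and `c'` respects diagonal and adjacency, and is stable under
2-FWL refinement. -/
structure FullBisim (G : SimpleGraph V) (G' : SimpleGraph V') (c : V → V → X)
    (c' : V' → V' → X) : Prop where
  diag : ∀ {u v u' v'}, c u v = c' u' v' → (u = v ↔ u' = v')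
  adj : ∀ {u v u' v'}, c u v = c' u' v' → (G.Adj u v ↔ G'.Adj u' v')
  stable : ∀ {u v u' v'}, c u v = c' u' v' →
    ((Finset.univ : Finset V).val.map fun t => (c u t, c t v)) =
      (Finset.univ : Finset V').val.map fun t => (c' u' t, c' t v')

namespace FullBisim

variable {G : SimpleGraph V} {G' : SimpleGraph V'} {c : V → V → X} {c' : V' → V' → X}
  {t u v w : V} {t' u' v' w' : V'}

theorem symm (h : FullBisim G G' c c') : FullBisim G' G c' c where
  diag e := (h.diag e.symm).symm
  adj e := (h.adj e.symm).symm
  stable e := (h.stable e.symm).symm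

theorem exists_mid (h : FullBisim G G' c c') (e : c u v = c' u' v') (t : V) :
    ∃ t', c u t = c' u' t' ∧ c t v = c' t' v' := by
  obtain ⟨t', -, e'⟩ := Multiset.exists_of_map_eq (h.stable e) (Finset.mem_univ_val t)
  exact ⟨t', congrArg Prod.fst e', congrArg Prod.snd e'⟩

theorem left (h : FullBisim G G' c c') (e : c u v = c' u' v') : c u u = c' u' u' := by
  obtain ⟨t', h1, -⟩ := h.exists_mid e u
  obtain rfl := (h.diag h1).1 rfl
  exact h1

theorem right (h : FullBisim G G' c c') (e : c u v = c' u' v') : c v v = c' v' v' := by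
  obtain ⟨t', -, h1⟩ := h.exists_mid e v
  obtain rfl := (h.diag h1).1 rfl
  exact h1

-- The sum defining a matrix product runs over the intermediate nodes that `stable` matches.
open Classical in
theorem adjMatrix_pow (h : FullBisim G G' c c') (e : c u v = c' u' v') (k : ℕ) :
    (G.adjMatrix ℝ ^ k) u v = (G'.adjMatrix ℝ ^ k) u' v' := by
  induction k generalizing u v u' v' with
  | zero => simp [Matrix.one_apply, h.diag e]
  | succ k ih =>
    rw [pow_succ, pow_succ, Matrix.mul_apply, Matrix.mul_apply]
    refine congrArg Multiset.sum (Multiset.map_congr_of_map_eq (h.stable e) fun t _ t' _ e' => ?_)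
    rw [ih (congrArg Prod.fst e'), SimpleGraph.adjMatrix_apply, SimpleGraph.adjMatrix_apply]
    simp only [h.adj (congrArg Prod.snd e')]

theorem reachable_iff (h : FullBisim G G' c c') (e : c u v = c' u' v') :
    G.Reachable u v ↔ G'.Reachable u' v' := by
  classical
  simp only [← SimpleGraph.exists_adjMatrix_pow_ne_zero_iff, h.adjMatrix_pow e]

/-- The three colours give all walk counts that enter the first-passage formula, hence the number of
walks of each length that avoid `w`. -/
theorem connAvoiding_iff (h : FullBisim G G' c c') (e : c u v = c' u' v')
    (e₁ : c u w = c' u' w') (e₂ : c w v = c' w' v') :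
    G.ConnAvoiding w u v ↔ G'.ConnAvoiding w' u' v' := by
  classical
  by_cases hw : w = v
  · have hw' := (h.diag e₂).1 hw
    exact ⟨fun h => absurd hw h.ne_right, fun h => absurd hw' h.ne_right⟩
  · have hw' := fun hh => hw ((h.diag e₂).2 hh)
    rw [← SimpleGraph.exists_killRow_pow_ne_zero_iff hw,
      ← SimpleGraph.exists_killRow_pow_ne_zero_iff hw']
    refine exists_congr fun k => ?_
    have := Matrix.pow_sub_killRow_pow_congr (P := G.adjMatrix ℝ) (P' := G'.adjMatrix ℝ)
      (n := k + 1) (fun k _ => h.adjMatrix_pow e₁ k) (fun k _ => h.adjMatrix_pow (h.right e₁) k)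
      (fun k _ => h.adjMatrix_pow e₂ k) (Nat.lt_succ_self k)
    rw [h.adjMatrix_pow e] at this
    rw [sub_right_inj.1 this]

theorem unsep (h : FullBisim G G' c c') (e : c u v = c' u' v') (hu : G.Unsep u v) :
    G'.Unsep u' v' := by
  refine ⟨fun hh => hu.ne ((h.diag e).2 hh), (h.reachable_iff e).1 hu.reachable,
    fun s' hs hs' => ?_⟩
  obtain ⟨s, h1, h2⟩ := h.symm.exists_mid e.symm s'
  refine (h.connAvoiding_iff e h1.symm h2.symm).1 (hu.connAvoiding ?_ ?_)
  · exact fun hh => hs ((h.diag h1.symm).1 hh.symm).symm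
  · exact fun hh => hs' ((h.diag h2.symm).1 hh)

theorem unsep_iff (h : FullBisim G G' c c') (e : c u v = c' u' v') :
    G.Unsep u v ↔ G'.Unsep u' v' :=
  ⟨h.unsep e, h.symm.unsep e.symm⟩

theorem spInteraction_iff (h : FullBisim G G' c c') (e : c u v = c' u' v')
    (e₁ : c u t = c' u' t') (e₂ : c t v = c' t' v') :
    SpInteraction G u t v ↔ SpInteraction G' u' t' v' := by
  rw [SimpleGraph.spInteraction_iff, SimpleGraph.spInteraction_iff, h.reachable_iff e,
    h.reachable_iff e₁, h.diag e, h.unsep_iff e, h.unsep_iff e₁, h.unsep_iff e₂, h.diag e₂,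
    eq_comm (a := t), h.diag e₁, eq_comm (a := u') (b := t')]
  simp only [ne_eq, h.diag e]

/-- The sparse neighbour set is cut out of all nodes by a condition on colours, so the matching of
intermediate nodes restricts to it. -/
theorem spRep_eq (h : FullBisim G G' c c') {I : Type} (M : MessagePassing I) {h₀ : V → V → I}
    {h₀' : V' → V' → I} (h0 : ∀ {u v u' v'}, c u v = c' u' v' → h₀ u v = h₀' u' v') (l : ℕ)
    (e : c u v = c' u' v') : M.spRep G h₀ l u v = M.spRep G' h₀' l u' v' := by
  classical
  induction l generalizing u v u' v' with
  | zero => exact h0 e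
  | succ l ih =>
    by_cases hr : G.Reachable u v
    · have hr' := (h.reachable_iff e).1 hr
      rw [MessagePassing.spRep_succ_of_reachable hr, MessagePassing.spRep_succ_of_reachable hr',
        ih e]
      congr 2
      refine Multiset.map_congr_of_map_eq (Multiset.filter_map_congr_of_map_eq (h.stable e)
        fun t _ t' _ e' => ?_) fun t _ t' _ e' => ?_
      · exact h.spInteraction_iff e (congrArg Prod.fst e') (congrArg Prod.snd e')
      · rw [ih (congrArg Prod.fst e'), ih (congrArg Prod.snd e')]
    · have hr' := fun hh => hr ((h.reachable_iff e).2 hh)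
      exact (if_neg hr).trans (if_neg hr').symm

end FullBisim

end FullStability

/-! ### From nodes to connected components. -/

section Components

variable {V V' : Type} [Fintype V] [Fintype V']

-- Double counting: nodes carry the invariant of their component, and one with size entry `x.2` has
-- `x.2` nodes.
open Classical in
theorem card_filter_component {γ : Type*} (G : SimpleGraph V) (z : G.ConnectedComponent → γ)
    (x : γ × ℕ) :
    (Finset.univ.filter fun u => (z (G.connectedComponentMk u),
      (Finset.univ.filter fun t => G.connectedComponentMk t = G.connectedComponentMk u).card)
        = x).card =
    ((Finset.univ.image G.connectedComponentMk).filter fun C =>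
      (z C, (Finset.univ.filter fun t => G.connectedComponentMk t = C).card) = x).card * x.2 := by
  rw [Finset.card_eq_sum_card_fiberwise (f := G.connectedComponentMk)
    (t := (Finset.univ.image G.connectedComponentMk).filter fun C =>
      (z C, (Finset.univ.filter fun t => G.connectedComponentMk t = C).card) = x)]
  · refine Finset.sum_const_nat fun C hC => ?_
    rw [Finset.mem_filter] at hC
    rw [Finset.filter_filter]
    rw [← congrArg Prod.snd hC.2]
    congr 1
    ext t
    simp only [Finset.mem_filter, Finset.mem_univ, true_and, and_iff_right_iff_imp]
    rintro rfl
    exact hC.2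
  · intro u hu
    exact Finset.mem_coe.2 (Finset.mem_filter.2
      ⟨Finset.mem_image_of_mem _ (Finset.mem_univ u), (Finset.mem_filter.1 hu).2⟩)

open Classical in
/-- The multiset of component invariants is determined by the multiset over all nodes, if the
invariants of a node determine the size of its component. -/
theorem map_component_congr {γ : Type*} {G : SimpleGraph V} {G' : SimpleGraph V'}
    {z : G.ConnectedComponent → γ} {z' : G'.ConnectedComponent → γ}
    (h : ((Finset.univ : Finset V).val.map fun u => (z (G.connectedComponentMk u),
      (Finset.univ.filter fun t => G.connectedComponentMk t = G.connectedComponentMk u).card)) =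
      (Finset.univ : Finset V').val.map fun u => (z' (G'.connectedComponentMk u),
        (Finset.univ.filter fun t => G'.connectedComponentMk t = G'.connectedComponentMk u).card)) :
    (Finset.univ.image G.connectedComponentMk).val.map z =
      (Finset.univ.image G'.connectedComponentMk).val.map z' := by
  suffices hs : (Finset.univ.image G.connectedComponentMk).val.map (fun C => (z C,
      (Finset.univ.filter fun t => G.connectedComponentMk t = C).card)) =
      (Finset.univ.image G'.connectedComponentMk).val.map (fun C => (z' C,
        (Finset.univ.filter fun t => G'.connectedComponentMk t = C).card)) from
    Multiset.map_congr_of_map_eq hs fun _ _ _ _ e => congrArg Prod.fst e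
  ext x
  have h1 := congrArg (Multiset.count x) h
  simp only [Multiset.count_map, eq_comm (a := x)] at h1 ⊢
  have key : ∀ {W : Type} [Fintype W] (F : SimpleGraph W) (y : F.ConnectedComponent → γ),
      x.2 = 0 → ((Finset.univ.image F.connectedComponentMk).filter fun C =>
        (y C, (Finset.univ.filter fun t => F.connectedComponentMk t = C).card) = x).card = 0 := by
    intro W _ F y hx
    rw [Finset.card_eq_zero, Finset.filter_eq_empty_iff]
    intro C hC e
    obtain ⟨t, -, ht⟩ := Finset.mem_image.1 hC
    have := (congrArg Prod.snd e).trans hx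
    rw [Finset.card_eq_zero, Finset.filter_eq_empty_iff] at this
    exact this (Finset.mem_univ t) ht
  have h2 := (card_filter_component G z x).symm.trans (h1.trans (card_filter_component G' z' x))
  -- No component is empty, so size `0` occurs on neither side; any other size cancels.
  by_cases hx : x.2 = 0
  · exact (key G z hx).trans (key G' z' hx).symm
  · exact Nat.eq_of_mul_eq_mul_right (Nat.pos_of_ne_zero hx) h2

end Components

/-! ### The universal standard model dominates all co-sparsified ones. -/

section StandardDominates

variable {dx de K : ℕ} {X : Type} {G H : AttrGraph dx de} {c : G.V → G.V → X} {c' : H.V → H.V → X}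

theorem FullBisim.compRep_eq (h : FullBisim G.graph H.graph c c')
    (h0 : ∀ {u v u' v'}, c u v = c' u' v' → initRep K G u v = initRep K H u' v')
    (M : CoSparsifiedGNN dx de K) {u : G.V} {u' : H.V} (e : c u u = c' u' u') :
    M.compRep G (G.graph.connectedComponentMk u) = M.compRep H (H.graph.connectedComponentMk u') := by
  classical
  unfold CoSparsifiedGNN.compRep
  simp only [SimpleGraph.ConnectedComponent.mem_supp_iff, SimpleGraph.ConnectedComponent.eq]
  congr 2
  · refine Multiset.map_congr_of_map_eq (Multiset.filter_map_congr_of_map_eq (h.stable e)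
        fun t _ t' _ e' => ?_) fun t _ t' _ e' => ?_
    · exact h.reachable_iff (congrArg Prod.snd e')
    · exact h.spRep_eq _ h0 _ (h.right (congrArg Prod.fst e'))
  -- Pairs `(s, t)` are listed by `s`: stability at `(u, u)` matches the choices of `s`, and
  -- stability at `(s, s)` those of `t`.
  · rw [Finset.filter_val, Finset.filter_val, ← Finset.univ_product_univ,
      ← Finset.univ_product_univ, Finset.product_val, Finset.product_val]
    simp only [SProd.sprod, Multiset.product, Multiset.filter_bind, Multiset.map_bind]
    refine Multiset.bind_congr_of_map_eq (h.stable e) fun s _ s' _ es => ?_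
    simp only [Multiset.filter_map, Multiset.map_map, Function.comp_def]
    have es2 := congrArg Prod.snd es
    refine Multiset.map_congr_of_map_eq (Multiset.filter_map_congr_of_map_eq
      (h.stable (h.left es2)) fun t _ t' _ e' => ?_) fun t _ t' _ e' => ?_
    · have h1 := h.reachable_iff es2
      have h2 := h.reachable_iff (congrArg Prod.fst e')
      have h3 := h.diag (congrArg Prod.fst e')
      simp only [ne_eq] at h2 h3 ⊢
      rw [h3, h1]
      refine and_congr_right fun hs' => and_congr_left fun _ => ?_
      have hs := h1.2 hs'
      exact ⟨fun ht => (h2.1 (hs.trans ht.symm)).symm.trans hs',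
        fun ht => (h2.2 (hs'.trans ht.symm)).symm.trans hs⟩
    · exact h.spRep_eq _ h0 _ (congrArg Prod.fst e')

theorem FullBisim.connected (h : FullBisim G.graph H.graph c c')
    (hD : ((Finset.univ : Finset G.V).val.map fun u => c u u) =
      (Finset.univ : Finset H.V).val.map fun u => c' u u) (hG : G.graph.Connected) :
    H.graph.Connected := by
  obtain ⟨u⟩ := hG.nonempty
  obtain ⟨u', -, e⟩ := Multiset.exists_of_map_eq hD (Finset.mem_univ_val u)
  rw [SimpleGraph.connected_iff_exists_forall_reachable]
  refine ⟨u', fun t' => ?_⟩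
  obtain ⟨t, h1, -⟩ := h.symm.exists_mid e.symm t'
  exact (h.symm.reachable_iff h1).2 (hG.preconnected u t)

theorem FullBisim.out_eq (h : FullBisim G.graph H.graph c c')
    (h0 : ∀ {u v u' v'}, c u v = c' u' v' → initRep K G u v = initRep K H u' v')
    (hD : ((Finset.univ : Finset G.V).val.map fun u => c u u) =
      (Finset.univ : Finset H.V).val.map fun u => c' u u)
    (M : CoSparsifiedGNN dx de K) : M.out G = M.out H := by
  classical
  by_cases hG : G.graph.Connected
  · have hH := h.connected hD hG
    rw [CoSparsifiedGNN.out, CoSparsifiedGNN.out, dif_pos hG, dif_pos hH]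
    obtain ⟨u', -, e⟩ := Multiset.exists_of_map_eq hD (Finset.mem_univ_val hG.nonempty.some)
    rw [h.compRep_eq h0 M e]
    congr 1
    exact SimpleGraph.ConnectedComponent.sound (hH.preconnected _ _)
  · have hH := fun hH => hG (h.symm.connected hD.symm hH)
    rw [CoSparsifiedGNN.out, CoSparsifiedGNN.out, dif_neg hG, dif_neg hH]
    congr 2
    refine map_component_congr (Multiset.map_congr_of_map_eq hD fun u _ u' _ e => ?_)
    refine Prod.ext (h.compRep_eq h0 M e) ?_
    have := congrArg Multiset.card (Multiset.filter_map_congr_of_map_eq (h.stable e)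
      (p := fun t => G.graph.connectedComponentMk t = G.graph.connectedComponentMk u)
      (p' := fun t => H.graph.connectedComponentMk t = H.graph.connectedComponentMk u')
      fun t _ t' _ e' => by
        rw [SimpleGraph.ConnectedComponent.eq, SimpleGraph.ConnectedComponent.eq]
        exact h.reachable_iff (congrArg Prod.snd e'))
    simp only [Multiset.card_map] at this
    exact this

theorem diag_map_eq_of_pairs {V V' : Type} [Fintype V] [Fintype V'] {c : V → V → X}
    {c' : V' → V' → X} (hdiag : ∀ {u v u' v'}, c u v = c' u' v' → (u = v ↔ u' = v'))
    (h : ((Finset.univ : Finset (V × V)).val.map fun p => c p.1 p.2) =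
      (Finset.univ : Finset (V' × V')).val.map fun p => c' p.1 p.2) :
    ((Finset.univ : Finset V).val.map fun u => c u u) =
      (Finset.univ : Finset V').val.map fun u => c' u u := by
  classical
  have key : ∀ {W : Type} [Fintype W] (d : W → W → X),
      ((Finset.univ : Finset (W × W)).val.filter fun p => p.1 = p.2).map (fun p => d p.1 p.2) =
      (Finset.univ : Finset W).val.map fun u => d u u := by
    intro W _ d
    have : ((Finset.univ : Finset (W × W)).filter fun p => p.1 = p.2) =
        (Finset.univ : Finset W).map ⟨fun u => (u, u), fun _ _ e => congrArg Prod.fst e⟩ := by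
      ext ⟨a, b⟩
      simp only [Finset.mem_filter, Finset.mem_univ, true_and, Finset.mem_map]
      constructor
      · rintro rfl
        exact ⟨a, rfl⟩
      · rintro ⟨_, e⟩
        exact (congrArg Prod.fst e).symm.trans (congrArg Prod.snd e)
    rw [← Finset.filter_val, this, Finset.map_val, Multiset.map_map]
    rfl
  rw [← key c, ← key c']
  exact Multiset.filter_map_congr_of_map_eq h fun p _ p' _ e => hdiag e

/-- Some standard model separates all graphs of the class that any co-sparsified one separates. -/
theorem exists_standardGNN_dominating (𝒢 : Set (AttrGraph dx de)) (N : ℕ)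
    (hN : ∀ G ∈ 𝒢, Fintype.card G.V ≤ N) (hinit : ConsistentInit K 𝒢) :
    ∃ U : StandardGNN dx de K, ∀ G ∈ 𝒢, ∀ H ∈ 𝒢, U.out G = U.out H →
      ∀ M : CoSparsifiedGNN dx de K, M.out G = M.out H := by
  -- Each graph has at most `N * N` pairs, and stabilization needs the product of the two counts.
  obtain ⟨U, hL, hU, hΨ⟩ := StandardGNN.exists_isInjective dx de K (N * N * (N * N))
  refine ⟨U, fun G hG H hH hout M => ?_⟩
  have h0 : ∀ {u v : G.V} {u' v' : H.V}, U.stdRep (initRep K G) U.depth u v =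
      U.stdRep (initRep K H) U.depth u' v' → initRep K G u v = initRep K H u' v' :=
    fun e => hU.stdRep_zero_of_eq e
  have hcard : Fintype.card (G.V × G.V) * Fintype.card (H.V × H.V) ≤ U.depth := by
    rw [hL, Fintype.card_prod, Fintype.card_prod]
    have := hN G hG
    have := hN H hH
    gcongr
  have hB : FullBisim G.graph H.graph (U.stdRep (initRep K G) U.depth)
      (U.stdRep (initRep K H) U.depth) :=
    { diag := fun e => (hinit G hG H hH _ _ _ _ (h0 e)).1
      adj := fun e => (hinit G hG H hH _ _ _ _ (h0 e)).2
      stable := fun e => hU.stdRep_stable hcard e }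
  exact hB.out_eq h0 (diag_map_eq_of_pairs hB.diag (U.readAgg_injective (hΨ hout))) M

end StandardDominates

/-! ### Chains of separators and the branches of a component. -/

section Chain

variable {V V' X : Type} [Fintype V] [Fintype V']

open Classical in
/-- The colors along the sequence of cut vertices that separate `u` from `v`. -/
noncomputable def colorChain (G : SimpleGraph V) (c : V → V → X) (u v : V) : List X :=
  if h : ∃ w, G.Reachable u v ∧ G.Unsep u w ∧ ¬ G.ConnAvoiding w u v then
    c u h.choose :: colorChain G c h.choose v
  else []
termination_by G.sepCount u v
decreasing_by
  exact SimpleGraph.sepCount_lt' h.choose_spec.1 h.choose_spec.2.1 h.choose_spec.2.2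

variable {G : SimpleGraph V} {c : V → V → X} {t u v w x : V}

theorem colorChain_self : colorChain G c u u = [] := by
  rw [colorChain, dif_neg]
  rintro ⟨w, -, h1, h2⟩
  exact h2 (.refl h1.ne.symm)

/-- By uniqueness of the first separator, the choice made in `colorChain` is immaterial. That
separator may be `v`, which ends the chain. -/
theorem colorChain_cons (hr : G.Reachable u v) (hw : G.Unsep u w)
    (hs : ¬ G.ConnAvoiding w u v) :
    colorChain G c u v = c u w :: colorChain G c w v := by
  have h : ∃ w, G.Reachable u v ∧ G.Unsep u w ∧ ¬ G.ConnAvoiding w u v := ⟨w, hr, hw, hs⟩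
  rw [colorChain, dif_pos h, h.choose_spec.2.1.eq_of_separates hw hr h.choose_spec.2.2 hs]

theorem colorChain_of_unsep (h : G.Unsep u v) : colorChain G c u v = [c u v] := by
  rw [colorChain_cons h.reachable h fun h => h.ne_right rfl, colorChain_self]

theorem exists_colorChain_eq_cons (hr : G.Reachable u v) (hne : u ≠ v) :
    ∃ w, G.Unsep u w ∧ ¬ G.ConnAvoiding w u v ∧ G.Reachable w v ∧
      colorChain G c u v = c u w :: colorChain G c w v := by
  obtain ⟨w, hw, hs⟩ := hr.exists_unsep hne
  exact ⟨w, hw, hs, hw.reachable.symm.trans hr, colorChain_cons hr hw hs⟩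

/-- By transitivity of separation, the first separator of `u` from `w` is also the first one of `u`
from `v`; induct on the separators that remain. -/
theorem colorChain_append (hr : G.Reachable u v) (hw : G.Reachable u w)
    (hs : ¬ G.ConnAvoiding w u v) :
    colorChain G c u v = colorChain G c u w ++ colorChain G c w v := by
  induction hn : G.sepCount u w using Nat.strong_induction_on generalizing u with
  | _ n ih =>
    by_cases huw : u = w
    · subst huw; rw [colorChain_self, List.nil_append]
    obtain ⟨x, hx, hxs, hxw, e⟩ := exists_colorChain_eq_cons (c := c) hw huw
    have hxv := SimpleGraph.not_connAvoiding_trans hw hr hxs hs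
    have hxr := hx.reachable.symm.trans hr
    rw [e, colorChain_cons hr hx hxv, List.cons_append]
    congr 1
    refine ih _ (hn ▸ SimpleGraph.sepCount_lt' hw hx hxs) hxr hxw (fun h => ?_) rfl
    exact hs ((hx.connAvoiding (Ne.symm huw) h.ne_left).trans h)

theorem colorChain_swap {τ : X → X} (hτ : ∀ u v, c v u = τ (c u v)) (hr : G.Reachable u v) :
    colorChain G c v u = (colorChain G c u v).reverse.map τ := by
  induction hn : G.sepCount u v using Nat.strong_induction_on generalizing u with
  | _ n ih =>
    by_cases huv : u = v
    · subst huv; simp [colorChain_self]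
    obtain ⟨w, hw, hs, hwr, e⟩ := exists_colorChain_eq_cons (c := c) hr huv
    rw [e, colorChain_append hr.symm hwr.symm (fun h => hs h.symm), colorChain_of_unsep hw.symm,
      ih _ (hn ▸ SimpleGraph.sepCount_lt' hr hw hs) hwr rfl]
    simp [hτ u w]

open Classical in
/-- The vertices of the component of `u`. -/
noncomputable def compVerts (G : SimpleGraph V) (u : V) : Finset V :=
  Finset.univ.filter fun t => G.Reachable u t

open Classical in
/-- The vertices that can be reached from `u` only through `w`. -/
noncomputable def beyond (G : SimpleGraph V) (u w : V) : Finset V :=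
  Finset.univ.filter fun t => G.Reachable u t ∧ ¬ G.ConnAvoiding w u t

open Classical in
/-- The vertices that can be reached from `u` without passing through `w`. -/
noncomputable def before (G : SimpleGraph V) (u w : V) : Finset V :=
  Finset.univ.filter fun t => G.ConnAvoiding w u t

open Classical in
/-- The vertices not separated from `w`. -/
noncomputable def unsepNbrs (G : SimpleGraph V) (w : V) : Finset V :=
  Finset.univ.filter fun x => G.Unsep w x

open Classical in
/-- The vertices not separated from `w` that `w` separates from `u`. -/
noncomputable def nextVerts (G : SimpleGraph V) (u w : V) : Finset V :=
  Finset.univ.filter fun x => G.Unsep w x ∧ ¬ G.ConnAvoiding w u x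

open Classical in
/-- The vertices separated neither from `u` nor from `w`. -/
noncomputable def commonVerts (G : SimpleGraph V) (u w : V) : Finset V :=
  Finset.univ.filter fun x => G.Unsep u x ∧ G.Unsep x w

@[simp] theorem mem_compVerts : t ∈ compVerts G u ↔ G.Reachable u t := by simp [compVerts]

@[simp] theorem mem_beyond :
    t ∈ beyond G u w ↔ G.Reachable u t ∧ ¬ G.ConnAvoiding w u t := by simp [beyond]

@[simp] theorem mem_before : t ∈ before G u w ↔ G.ConnAvoiding w u t := by simp [before]

@[simp] theorem mem_unsepNbrs : t ∈ unsepNbrs G u ↔ G.Unsep u t := by simp [unsepNbrs]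

@[simp] theorem mem_nextVerts :
    t ∈ nextVerts G u w ↔ G.Unsep w t ∧ ¬ G.ConnAvoiding w u t := by simp [nextVerts]

@[simp] theorem mem_commonVerts :
    t ∈ commonVerts G u w ↔ G.Unsep u t ∧ G.Unsep t w := by simp [commonVerts]

theorem compVerts_eq_of_reachable (h : G.Reachable u v) : compVerts G u = compVerts G v := by
  ext t
  simp only [mem_compVerts]
  exact ⟨h.symm.trans, h.trans⟩

theorem compVerts_val (G : SimpleGraph V) (u w : V) :
    (compVerts G u).val = (beyond G u w).val + (before G u w).val := by
  classical
  have hd : Disjoint (beyond G u w) (before G u w) := by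
    rw [Finset.disjoint_left]
    intro t h1 h2
    exact (mem_beyond.1 h1).2 (mem_before.1 h2)
  have : compVerts G u = (beyond G u w).disjUnion (before G u w) hd := by
    ext t
    simp only [mem_compVerts, Finset.mem_disjUnion, mem_beyond, mem_before]
    exact ⟨fun h => (em (G.ConnAvoiding w u t)).elim .inr fun h' => .inl ⟨h, h'⟩,
      fun h => h.elim And.left fun h => h.reachable⟩
  rw [this]
  rfl

theorem beyond_pairwiseDisjoint (w : V) {s : Finset V} (hs : ∀ x ∈ s, G.Unsep w x) :
    (s : Set V).PairwiseDisjoint (beyond G w) := by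
  classical
  intro x hx y hy hxy
  rw [Function.onFun, Finset.disjoint_left]
  intro t h1 h2
  rw [mem_beyond] at h1 h2
  exact hxy ((hs x hx).eq_of_separates (hs y hy) h1.1 h1.2 h2.2)

/-- Each further vertex lies behind its unique first separator from `w`; these are the branches at
the root `w`. -/
theorem compVerts_val_eq_bind (G : SimpleGraph V) (w : V) :
    (compVerts G w).val = w ::ₘ (unsepNbrs G w).val.bind fun x => (beyond G w x).val := by
  classical
  have hd := beyond_pairwiseDisjoint (G := G) w (s := unsepNbrs G w) fun x hx => mem_unsepNbrs.1 hx
  have hw : w ∉ (unsepNbrs G w).disjiUnion (beyond G w) hd := by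
    simp only [Finset.mem_disjiUnion, mem_unsepNbrs, mem_beyond, not_exists, not_and]
    exact fun x hx _ h => h (.refl hx.ne.symm)
  have : compVerts G w = ((unsepNbrs G w).disjiUnion (beyond G w) hd).cons w hw := by
    ext t
    simp only [mem_compVerts, Finset.mem_cons, Finset.mem_disjiUnion, mem_unsepNbrs, mem_beyond]
    constructor
    · intro h
      by_cases htw : t = w
      · exact .inl htw
      · obtain ⟨x, hx, hx'⟩ := h.exists_unsep (Ne.symm htw)
        exact .inr ⟨x, hx, h, hx'⟩
    · rintro (rfl | ⟨x, hx, h, -⟩)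
      exacts [.refl _, h]
  rw [this]
  rfl

/-- A branch with root `w` forks into the branches at `w` that lead away from `u`. -/
theorem beyond_val_eq_bind (h : G.Unsep u w) :
    (beyond G u w).val = w ::ₘ (nextVerts G u w).val.bind fun x => (beyond G w x).val := by
  classical
  have hd := beyond_pairwiseDisjoint (G := G) w (s := nextVerts G u w)
    fun x hx => (mem_nextVerts.1 hx).1
  have hw : w ∉ (nextVerts G u w).disjiUnion (beyond G w) hd := by
    simp only [Finset.mem_disjiUnion, mem_nextVerts, mem_beyond, not_exists, not_and]
    exact fun x hx _ h => h (.refl hx.1.ne.symm)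
  have : beyond G u w = ((nextVerts G u w).disjiUnion (beyond G w) hd).cons w hw := by
    ext t
    simp only [mem_beyond, Finset.mem_cons, Finset.mem_disjiUnion, mem_nextVerts]
    constructor
    · rintro ⟨hr, hs⟩
      by_cases htw : t = w
      · exact .inl htw
      · have hwt := h.reachable.symm.trans hr
        obtain ⟨x, hx, hx'⟩ := hwt.exists_unsep (Ne.symm htw)
        refine .inr ⟨x, ⟨hx, fun hux => hs ?_⟩, hwt, hx'⟩
        exact hux.trans (SimpleGraph.connAvoiding_of_not hwt hx.ne.symm hx')
    · rintro (rfl | ⟨x, ⟨hx, hux⟩, hr, hs⟩)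
      · exact ⟨h.reachable, fun h => h.ne_right rfl⟩
      · refine ⟨h.reachable.trans hr, fun hut => hux ?_⟩
        exact hut.trans (SimpleGraph.connAvoiding_of_not hr hx.ne.symm hs).symm
  rw [this]
  rfl

/-- Only `w` can separate `u` from an unseparated neighbour of `w`, by `Unsep.not_unsep_iff`. -/
theorem unsepNbrs_val (h : G.Unsep u w) :
    (unsepNbrs G w).val = (nextVerts G u w).val + u ::ₘ (commonVerts G u w).val := by
  classical
  have hu : u ∉ commonVerts G u w := by
    rw [mem_commonVerts]
    exact fun h => h.1.ne rfl
  have hd : Disjoint (nextVerts G u w) ((commonVerts G u w).cons u hu) := by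
    rw [Finset.disjoint_left]
    intro x h1 h2
    rw [mem_nextVerts] at h1
    rw [Finset.mem_cons, mem_commonVerts] at h2
    rcases h2 with rfl | h2
    · exact h1.2 (.refl h.ne.symm)
    · exact h1.2 (h2.1.connAvoiding h.ne.symm h2.2.ne.symm)
  have : unsepNbrs G w = (nextVerts G u w).disjUnion _ hd := by
    ext x
    simp only [mem_unsepNbrs, Finset.mem_disjUnion, mem_nextVerts, Finset.mem_cons,
      mem_commonVerts]
    constructor
    · intro hx
      by_cases hxu : x = u
      · exact .inr (.inl hxu)
      · by_cases hux : G.Unsep u x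
        · exact .inr (.inr ⟨hux, hx.symm⟩)
        · exact .inl ⟨hx, (h.not_unsep_iff hx hxu).1 hux⟩
    · rintro (h1 | rfl | h1)
      exacts [h1.1, h.symm, h1.2.symm]
  rw [this]
  rfl

/-- If `u` does not cut such a vertex off from `w`, its first separator from `u` is unseparated from
`w` too. -/
theorem before_val (h : G.Unsep u w) :
    (before G u w).val =
      (beyond G w u).val + (commonVerts G u w).val.bind fun x => (beyond G u x).val := by
  classical
  have hd := beyond_pairwiseDisjoint (G := G) u (s := commonVerts G u w)
    fun x hx => (mem_commonVerts.1 hx).1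
  have key : ∀ x t, G.Unsep u x → G.Unsep x w → t ∈ beyond G u x →
      G.ConnAvoiding w u t ∧ G.ConnAvoiding u w t := by
    intro x t hux hxw ht
    rw [mem_beyond] at ht
    have hxt := SimpleGraph.connAvoiding_of_not ht.1 hux.ne.symm ht.2
    have hxuw := h.connAvoiding hux.ne.symm hxw.ne
    refine ⟨?_, (hxw.symm.connAvoiding h.ne hux.ne).trans hxt⟩
    rcases (ht.1.symm.trans hux.reachable).connAvoiding_or hxw.ne with h1 | h1
    · exact (hux.connAvoiding h.ne.symm hxw.ne.symm).trans h1.symm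
    · exact absurd (hxuw.trans h1.symm) ht.2
  have hd' : Disjoint (beyond G w u) ((commonVerts G u w).disjiUnion (beyond G u) hd) := by
    rw [Finset.disjoint_left]
    intro t h1 h2
    rw [Finset.mem_disjiUnion] at h2
    obtain ⟨x, hx, ht⟩ := h2
    rw [mem_commonVerts] at hx
    exact (mem_beyond.1 h1).2 (key x t hx.1 hx.2 ht).2
  have : before G u w = (beyond G w u).disjUnion _ hd' := by
    ext t
    rw [mem_before, Finset.mem_disjUnion, Finset.mem_disjiUnion]
    constructor
    · intro ht
      by_cases hwt : G.ConnAvoiding u w t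
      · right
        obtain ⟨x, hx, hxt⟩ := ht.reachable.exists_unsep hwt.ne_right
        have hxw : x ≠ w := by rintro rfl; exact hxt ht
        refine ⟨x, mem_commonVerts.2 ⟨hx, ?_⟩, mem_beyond.2 ⟨ht.reachable, hxt⟩⟩
        by_contra hn
        have := (hx.symm.not_unsep_iff h hxw.symm).1 hn
        exact this ((SimpleGraph.connAvoiding_of_not ht.reachable hx.ne.symm hxt).trans hwt.symm)
      · exact .inl (mem_beyond.2 ⟨h.reachable.symm.trans ht.reachable, hwt⟩)
    · rintro (ht | ⟨x, hx, ht⟩)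
      · rw [mem_beyond] at ht
        exact SimpleGraph.connAvoiding_of_not ht.1 h.ne ht.2
      · rw [mem_commonVerts] at hx
        exact (key x t hx.1 hx.2 ht).1
  rw [this]
  rfl

end Chain

/-! ### Sparse stable colours determine chains within a component. -/

section SparseStability

variable {V V' X : Type} [Fintype V] [Fintype V']

/-- Equality of the colors `c` and `c'` of pairs within components respects diagonal and
separation, and is stable under refinement within components and blocks. -/
structure SparseBisim (G : SimpleGraph V) (G' : SimpleGraph V') (c : V → V → X) (c' : V' → V' → X)
    (τ : X → X) : Prop where
  swap : ∀ u v, c v u = τ (c u v)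
  swap' : ∀ u v, c' v u = τ (c' u v)
  left : ∀ {u v u' v'}, G.Reachable u v → G'.Reachable u' v' → c u v = c' u' v' →
    c u u = c' u' u'
  unsep : ∀ {u v u' v'}, G.Reachable u v → G'.Reachable u' v' → c u v = c' u' v' →
    (G.Unsep u v ↔ G'.Unsep u' v')
  comp : ∀ {u u'}, c u u = c' u' u' →
    (compVerts G u).val.map (c u) = (compVerts G' u').val.map (c' u')
  common : ∀ {u v u' v'}, G.Unsep u v → G'.Unsep u' v' → c u v = c' u' v' →
    ((commonVerts G u v).val.map fun t => (c u t, c t v)) =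
      (commonVerts G' u' v').val.map fun t => (c' u' t, c' t v')

namespace SparseBisim

variable {G : SimpleGraph V} {G' : SimpleGraph V'} {c : V → V → X} {c' : V' → V' → X} {τ : X → X}
  {t u v w : V} {t' u' v' w' : V'}

theorem swap_eq (h : SparseBisim G G' c c' τ) (e : c u v = c' u' v') : c v u = c' v' u' := by
  rw [h.swap u v, h.swap' u' v', e]

theorem right (h : SparseBisim G G' c c' τ) (hr : G.Reachable u v) (hr' : G'.Reachable u' v')
    (e : c u v = c' u' v') : c v v = c' v' v' :=
  h.left hr.symm hr'.symm (h.swap_eq e)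

theorem unsepNbrs_map (h : SparseBisim G G' c c' τ) (e : c w w = c' w' w') :
    (unsepNbrs G w).val.map (c w) = (unsepNbrs G' w').val.map (c' w') := by
  classical
  have key : ∀ {W : Type} [Fintype W] (F : SimpleGraph W) (w : W),
      unsepNbrs F w = (compVerts F w).filter fun t => F.Unsep w t := by
    intro W _ F w
    ext t
    simp only [mem_unsepNbrs, Finset.mem_filter, mem_compVerts]
    exact ⟨fun h => ⟨h.reachable, h⟩, And.right⟩
  rw [key, key, Finset.filter_val, Finset.filter_val]
  refine Multiset.filter_map_congr_of_map_eq (h.comp e) fun t ht t' ht' e' => ?_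
  exact h.unsep (mem_compVerts.1 ht) (mem_compVerts.1 ht') e'

/-- By cancellation: the colour at `w` determines all its unseparated neighbours, and the colour of
the pair those outside `nextVerts`. -/
theorem nextVerts_map (h : SparseBisim G G' c c' τ) (hu : G.Unsep u w) (hu' : G'.Unsep u' w')
    (e : c u w = c' u' w') :
    (nextVerts G u w).val.map (c w) = (nextVerts G' u' w').val.map (c' w') := by
  have h1 := h.unsepNbrs_map (h.right hu.reachable hu'.reachable e)
  rw [unsepNbrs_val hu, unsepNbrs_val hu', Multiset.map_add, Multiset.map_add, Multiset.map_cons,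
    Multiset.map_cons, h.swap_eq e,
    Multiset.map_congr_of_map_eq (h.common hu hu' e) (g := c w) (g' := c' w')
      fun t _ t' _ e' => h.swap_eq (congrArg Prod.snd e')] at h1
  exact Multiset.add_left_inj.1 h1

theorem map_beyond_eq_bind {c : V → V → X} (s : Multiset V) (hs : ∀ x ∈ s, G.Unsep w x) :
    (s.bind fun x => (beyond G w x).val).map (colorChain G c w) =
      s.bind fun x => ((beyond G w x).val.map (colorChain G c x)).map (List.cons (c w x)) := by
  rw [Multiset.map_bind]
  refine Multiset.bind_congr fun x hx => ?_
  rw [Multiset.map_map]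
  refine Multiset.map_congr rfl fun t ht => ?_
  have ht := mem_beyond.1 ht
  exact colorChain_cons ht.1 (hs x hx) ht.2

theorem beyond_map_eq {c : V → V → X} (hu : G.Unsep u w) :
    (beyond G u w).val.map (colorChain G c w) = [] ::ₘ (nextVerts G u w).val.bind fun x =>
      ((beyond G w x).val.map (colorChain G c x)).map (List.cons (c w x)) := by
  rw [beyond_val_eq_bind hu, Multiset.map_cons, colorChain_self, map_beyond_eq_bind _
    fun x hx => (mem_nextVerts.1 hx).1]

/-- Induction on the size of the branch: the colour of its root pair determines the colours of the
pairs at its forks. -/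
theorem beyond_map (h : SparseBisim G G' c c' τ) (hu : G.Unsep u w) (hu' : G'.Unsep u' w')
    (e : c u w = c' u' w') :
    (beyond G u w).val.map (colorChain G c w) =
      (beyond G' u' w').val.map (colorChain G' c' w') := by
  induction hn : (beyond G u w).card using Nat.strong_induction_on generalizing u w u' w' with
  | _ n ih =>
    rw [beyond_map_eq hu, beyond_map_eq hu']
    congr 1
    refine Multiset.bind_congr_of_map_eq (h.nextVerts_map hu hu' e) fun x hx x' hx' ex => ?_
    have hx1 := (mem_nextVerts.1 hx).1
    have hx1' := (mem_nextVerts.1 hx').1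
    rw [ex, ih _ ?_ hx1 hx1' ex rfl]
    -- The root `w` lies in the branch but in none of its forks, so these are smaller.
    rw [← hn, ← Finset.card_val (beyond G u w), beyond_val_eq_bind hu, Multiset.card_cons,
      Nat.lt_succ_iff, Multiset.card_bind]
    exact Multiset.single_le_sum (fun _ _ => Nat.zero_le _) _
      (Multiset.mem_map_of_mem (fun x => Multiset.card (beyond G w x).val) hx)

theorem comp_map (h : SparseBisim G G' c c' τ) (e : c w w = c' w' w') :
    (compVerts G w).val.map (colorChain G c w) =
      (compVerts G' w').val.map (colorChain G' c' w') := by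
  rw [compVerts_val_eq_bind, compVerts_val_eq_bind, Multiset.map_cons, Multiset.map_cons,
    colorChain_self, colorChain_self,
    map_beyond_eq_bind _ fun x hx => mem_unsepNbrs.1 hx,
    map_beyond_eq_bind _ fun x hx => mem_unsepNbrs.1 hx]
  congr 1
  refine Multiset.bind_congr_of_map_eq (h.unsepNbrs_map e) fun x hx x' hx' ex => ?_
  rw [ex, h.beyond_map (mem_unsepNbrs.1 hx)
    (mem_unsepNbrs.1 hx') ex]

/-- The whole component is determined by the colour at `w`, and the branch beyond `w` cancels. -/
theorem before_map (h : SparseBisim G G' c c' τ) (hu : G.Unsep u w) (hu' : G'.Unsep u' w')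
    (e : c u w = c' u' w') :
    (before G u w).val.map (colorChain G c w) =
      (before G' u' w').val.map (colorChain G' c' w') := by
  have h1 := h.comp_map (h.right hu.reachable hu'.reachable e)
  rw [← compVerts_eq_of_reachable hu.reachable, ← compVerts_eq_of_reachable hu'.reachable,
    compVerts_val G u w, compVerts_val G' u' w', Multiset.map_add, Multiset.map_add,
    h.beyond_map hu hu' e] at h1
  exact Multiset.add_right_inj.1 h1

/-- The chains between the vertices on the side of `u` and an unseparated pair `u`, `w`. -/
theorem before_pair_map_eq {c : V → V → X} (hτ : ∀ u v, c v u = τ (c u v)) (hu : G.Unsep u w) :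
    ((before G u w).val.map fun t => (colorChain G c u t, colorChain G c t w)) =
      ((beyond G w u).val.map (colorChain G c u)).map
          (fun l => (l, l.reverse.map τ ++ [c u w])) +
        (commonVerts G u w).val.bind fun x => ((beyond G u x).val.map (colorChain G c x)).map
          fun l => (c u x :: l, l.reverse.map τ ++ [c x w]) := by
  rw [before_val hu, Multiset.map_add, Multiset.map_bind, Multiset.map_map]
  congr 1
  · refine Multiset.map_congr rfl fun t ht => ?_
    have ht := mem_beyond.1 ht
    have hut := hu.reachable.trans ht.1
    rw [Function.comp_apply, ← colorChain_swap hτ hut, ← colorChain_of_unsep hu,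
      ← colorChain_append ht.1.symm hut.symm fun hh => ht.2 hh.symm]
  · refine Multiset.bind_congr fun x hx => ?_
    have hx := mem_commonVerts.1 hx
    rw [Multiset.map_map]
    refine Multiset.map_congr rfl fun t ht => ?_
    have ht := mem_beyond.1 ht
    have hxt := hx.1.reachable.symm.trans ht.1
    rw [Function.comp_apply, ← colorChain_swap hτ hxt, ← colorChain_of_unsep hx.2,
      ← colorChain_append (hxt.symm.trans hx.2.reachable) hxt.symm,
      colorChain_cons ht.1 hx.1 ht.2]
    exact fun hh => ht.2 ((hu.connAvoiding hx.1.ne.symm hx.2.ne).trans hh.symm)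

theorem before_pair_map (h : SparseBisim G G' c c' τ) (hu : G.Unsep u w) (hu' : G'.Unsep u' w')
    (e : c u w = c' u' w') :
    ((before G u w).val.map fun t => (colorChain G c u t, colorChain G c t w)) =
      (before G' u' w').val.map fun t => (colorChain G' c' u' t, colorChain G' c' t w') := by
  rw [before_pair_map_eq h.swap hu, before_pair_map_eq h.swap' hu',
    h.beyond_map hu.symm hu'.symm (h.swap_eq e), e]
  congr 1
  refine Multiset.bind_congr_of_map_eq (h.common hu hu' e) fun x hx x' hx' ex => ?_
  have e1 := congrArg Prod.fst ex
  have e2 := congrArg Prod.snd ex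
  simp only at e1 e2
  rw [h.beyond_map (mem_commonVerts.1 hx).1
    (mem_commonVerts.1 hx').1 e1, e1, e2]

theorem colorChain_append_of_before {c : V → V → X} (hr : G.Reachable u v)
    (hu : G.Unsep u w) (hs : ¬ G.ConnAvoiding w u v) (ht : G.ConnAvoiding w u t) :
    colorChain G c t v = colorChain G c t w ++ colorChain G c w v :=
  colorChain_append (ht.reachable.symm.trans hr) (ht.reachable.symm.trans hu.reachable)
    fun hh => hs (ht.trans hh)

theorem eq_iff_of_colorChain_eq (hr : G.Reachable u v) (hr' : G'.Reachable u' v')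
    (el : colorChain G c u v = colorChain G' c' u' v') : u = v ↔ u' = v' := by
  constructor
  · rintro rfl
    by_contra hne
    obtain ⟨w, -, -, -, e'⟩ := exists_colorChain_eq_cons (c := c') hr' hne
    rw [colorChain_self, e'] at el
    exact List.cons_ne_nil _ _ el.symm
  · rintro rfl
    by_contra hne
    obtain ⟨w, -, -, -, e'⟩ := exists_colorChain_eq_cons (c := c) hr hne
    rw [colorChain_self, e'] at el
    exact List.cons_ne_nil _ _ el

/-- Refinement within a component: the chains to a third vertex are determined by the chain of
the pair. -/
theorem pair_map (h : SparseBisim G G' c c' τ) (hr : G.Reachable u v) (hr' : G'.Reachable u' v')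
    (e : c u u = c' u' u') (el : colorChain G c u v = colorChain G' c' u' v') :
    ((compVerts G u).val.map fun t => (colorChain G c u t, colorChain G c t v)) =
      (compVerts G' u').val.map fun t => (colorChain G' c' u' t, colorChain G' c' t v') := by
  induction hn : G.sepCount u v using Nat.strong_induction_on generalizing u u' with
  | _ n ih =>
    by_cases huv : u = v
    · subst huv
      obtain rfl := (eq_iff_of_colorChain_eq hr hr' el).1 rfl
      have key : ∀ {W : Type} [Fintype W] (F : SimpleGraph W) (d : W → W → X)
          (_ : ∀ u v, d v u = τ (d u v)) (u : W),
          ((compVerts F u).val.map fun t => (colorChain F d u t, colorChain F d t u)) =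
            ((compVerts F u).val.map (colorChain F d u)).map fun l => (l, l.reverse.map τ) := by
        intro W _ F d hd u
        rw [Multiset.map_map]
        refine Multiset.map_congr rfl fun t ht => ?_
        rw [Function.comp_apply, colorChain_swap hd (mem_compVerts.1 ht)]
      rw [key G c h.swap, key G' c' h.swap', h.comp_map e]
    · have huv' := fun hh => huv ((eq_iff_of_colorChain_eq hr hr' el).2 hh)
      obtain ⟨w, hw, hs, hwr, ew⟩ := exists_colorChain_eq_cons (c := c) hr huv
      obtain ⟨w', hw', hs', hwr', ew'⟩ := exists_colorChain_eq_cons (c := c') hr' huv'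
      rw [ew, ew', List.cons.injEq] at el
      obtain ⟨e1, e2⟩ := el
      have ih := ih _ (hn ▸ SimpleGraph.sepCount_lt' hr hw hs) hwr hwr'
        (h.right hw.reachable hw'.reachable e1) e2 rfl
      rw [← compVerts_eq_of_reachable hw.reachable, ← compVerts_eq_of_reachable hw'.reachable,
        compVerts_val G u w, compVerts_val G' u' w', Multiset.map_add, Multiset.map_add] at ih
      -- The induction hypothesis at `w`, `v` covers the whole component. Before `w`, chains to `v`
      -- run through `w` and are already determined; cancelling them leaves the part beyond `w`.
      have key1 : ((before G u w).val.map fun t => (colorChain G c w t, colorChain G c t v)) =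
          (before G' u' w').val.map fun t => (colorChain G' c' w' t, colorChain G' c' t v') := by
        refine Multiset.map_congr_of_map_eq (h.before_map hw hw' e1) fun t ht t' ht' et => ?_
        have ht := mem_before.1 ht
        have ht' := mem_before.1 ht'
        rw [colorChain_append_of_before hr hw hs ht, colorChain_append_of_before hr' hw' hs' ht',
          colorChain_swap h.swap (hw.reachable.symm.trans ht.reachable),
          colorChain_swap h.swap' (hw'.reachable.symm.trans ht'.reachable), et, e2]
      rw [key1] at ih
      rw [compVerts_val G u w, compVerts_val G' u' w', Multiset.map_add, Multiset.map_add]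
      -- Beyond `w` the chain from `u` only gains its first entry; before `w` the chain to `v`
      -- splits at `w`.
      refine congrArg₂ (· + ·) ?_ ?_
      · refine Multiset.map_congr_of_map_eq (Multiset.add_left_inj.1 ih) fun t ht t' ht' et => ?_
        have ht := mem_beyond.1 ht
        have ht' := mem_beyond.1 ht'
        have et1 := congrArg Prod.fst et
        have et2 := congrArg Prod.snd et
        simp only at et1 et2
        rw [colorChain_cons ht.1 hw ht.2, colorChain_cons ht'.1 hw' ht'.2, e1, et1, et2]
      · refine Multiset.map_congr_of_map_eq (h.before_pair_map hw hw' e1) fun t ht t' ht' et => ?_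
        have ht := mem_before.1 ht
        have ht' := mem_before.1 ht'
        have et1 := congrArg Prod.fst et
        have et2 := congrArg Prod.snd et
        simp only at et1 et2
        rw [colorChain_append_of_before hr hw hs ht, colorChain_append_of_before hr' hw' hs' ht',
          et1, et2, e2]

/-- Induction along two equal chains. -/
theorem colorChain_induction {motive : V → V' → Prop} (hr : G.Reachable u v)
    (hr' : G'.Reachable u' v') (h : SparseBisim G G' c c' τ) (e : c u u = c' u' u')
    (el : colorChain G c u v = colorChain G' c' u' v') (base : c v v = c' v' v' → motive v v')
    (step : ∀ {u w u' w'}, G.Reachable u v → G'.Reachable u' v' → G.Unsep u w → G'.Unsep u' w' →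
      ¬ G.ConnAvoiding w u v → ¬ G'.ConnAvoiding w' u' v' → (w = v ↔ w' = v') →
      c u w = c' u' w' → motive w w' → motive u u') :
    motive u u' := by
  induction hn : G.sepCount u v using Nat.strong_induction_on generalizing u u' with
  | _ n ih =>
    have hiff := eq_iff_of_colorChain_eq hr hr' el
    by_cases huv : u = v
    · obtain rfl := hiff.1 huv
      subst huv
      exact base e
    · have huv' := fun hh => huv (hiff.2 hh)
      obtain ⟨w, hw, hs, hwr, ew⟩ := exists_colorChain_eq_cons (c := c) hr huv
      obtain ⟨w', hw', hs', hwr', ew'⟩ := exists_colorChain_eq_cons (c := c') hr' huv'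
      rw [ew, ew', List.cons.injEq] at el
      exact step hr hr' hw hw' hs hs' (eq_iff_of_colorChain_eq hwr hwr' el.2) el.1
        (ih _ (hn ▸ SimpleGraph.sepCount_lt' hr hw hs) hwr hwr'
          (h.right hw.reachable hw'.reachable el.1) el.2 rfl)

theorem end_eq (h : SparseBisim G G' c c' τ) (hr : G.Reachable u v) (hr' : G'.Reachable u' v')
    (e : c u u = c' u' u') (el : colorChain G c u v = colorChain G' c' u' v') :
    c v v = c' v' v' :=
  colorChain_induction (motive := fun _ _ => c v v = c' v' v') hr hr' h e el id
    fun _ _ _ _ _ _ _ _ hm => hm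

-- If the first separator `w` is not `v`, the killed power vanishes and first passage expresses the
-- entry by those of `(u, w)`, `(w, w)` and `(w, v)`. No exponent beyond `k` occurs, so the powers
-- below `n` suffice.
open Classical in
theorem pow_eq (h : SparseBisim G G' c c' τ) {P : Matrix V V ℝ} {P' : Matrix V' V' ℝ}
    (hP : ∀ x y, P x y ≠ 0 → G.Adj x y) (hP' : ∀ x y, P' x y ≠ 0 → G'.Adj x y) {n : ℕ}
    (hc : ∀ {u v u' v'}, G.Reachable u v → G'.Reachable u' v' → c u v = c' u' v' →
      ∀ k < n, (P ^ k) u v = (P' ^ k) u' v') (hr : G.Reachable u v) (hr' : G'.Reachable u' v')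
    (e : c u u = c' u' u') (el : colorChain G c u v = colorChain G' c' u' v') :
    ∀ k < n, (P ^ k) u v = (P' ^ k) u' v' := by
  refine colorChain_induction (motive := fun u u' => ∀ k < n, (P ^ k) u v = (P' ^ k) u' v')
    hr hr' h e el (hc (.refl _) (.refl _)) ?_
  intro u w u' w' hr hr' hw hw' hs hs' hiff e ih k hk
  -- For `w = v` the killed power need not vanish, but then the pair is unseparated and has a colour
  -- of its own.
  by_cases hwv : w = v
  · obtain rfl := hiff.1 hwv
    subst hwv
    exact hc hr hr' e k hk
  · have hwv' := fun hh => hwv (hiff.2 hh)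
    have := Matrix.pow_sub_killRow_pow_congr (hc hw.reachable hw'.reachable e)
      (hc (.refl _) (.refl _) (h.right hw.reachable hw'.reachable e)) ih hk
    rwa [SimpleGraph.killRow_pow_eq_zero hP hs hwv, SimpleGraph.killRow_pow_eq_zero hP' hs' hwv',
      sub_zero, sub_zero] at this

theorem eq_of_unsep (hr : G.Reachable u v) (hr' : G'.Reachable u' v')
    (el : colorChain G c u v = colorChain G' c' u' v') (hu : G.Unsep u v) :
    c u v = c' u' v' ∧ G'.Unsep u' v' := by
  have hne' := fun hh => hu.ne ((eq_iff_of_colorChain_eq hr hr' el).2 hh)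
  obtain ⟨w', hw', hs', hwr', ew'⟩ := exists_colorChain_eq_cons (c := c') hr' hne'
  rw [colorChain_of_unsep hu, ew', List.cons.injEq, ← colorChain_self (G := G) (c := c) (u := v)]
    at el
  obtain rfl := (eq_iff_of_colorChain_eq (.refl _) hwr' el.2).1 rfl
  exact ⟨el.1, hw'⟩

end SparseBisim

end SparseStability

/-! ### Chain colours are stable under full 2-FWL refinement. -/

section ChainColor

variable {V V' X : Type} [Fintype V] [Fintype V']

open Classical in
/-- The colors of the ends of a pair, and the chain between them if they are connected. -/
noncomputable def chainColor (G : SimpleGraph V) (c : V → V → X) (u v : V) :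
    X × X × Option (List X) :=
  (c u u, c v v, if G.Reachable u v then some (colorChain G c u v) else none)

variable {G : SimpleGraph V} {G' : SimpleGraph V'} {c : V → V → X} {c' : V' → V' → X} {τ : X → X}
  {t u v w : V} {t' u' v' w' : V'}

theorem chainColor_of_reachable (h : G.Reachable u v) :
    chainColor G c u v = (c u u, c v v, some (colorChain G c u v)) := by
  rw [chainColor, if_pos h]

theorem chainColor_of_not_reachable (h : ¬ G.Reachable u v) :
    chainColor G c u v = (c u u, c v v, none) := by
  rw [chainColor, if_neg h]

theorem reachable_iff_of_chainColor_eq (e : chainColor G c u v = chainColor G' c' u' v') :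
    G.Reachable u v ↔ G'.Reachable u' v' := by
  have e := congrArg (fun x => x.2.2.isSome) e
  by_cases h : G.Reachable u v <;> by_cases h' : G'.Reachable u' v' <;>
    simp [chainColor, h, h'] at e ⊢

theorem colorChain_eq_of_chainColor_eq (e : chainColor G c u v = chainColor G' c' u' v')
    (hr : G.Reachable u v) : colorChain G c u v = colorChain G' c' u' v' := by
  have hr' := (reachable_iff_of_chainColor_eq e).1 hr
  rw [chainColor_of_reachable hr, chainColor_of_reachable hr'] at e
  exact Option.some.inj (congrArg (fun x => x.2.2) e)

open Classical in
/-- The vertices outside the component of `u`. -/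
noncomputable def outsideVerts (G : SimpleGraph V) (u : V) : Finset V :=
  Finset.univ.filter fun t => ¬ G.Reachable u t

@[simp] theorem mem_outsideVerts : t ∈ outsideVerts G u ↔ ¬ G.Reachable u t := by
  simp [outsideVerts]

theorem univ_val_eq (G : SimpleGraph V) (u : V) :
    (Finset.univ : Finset V).val = (compVerts G u).val + (outsideVerts G u).val := by
  classical
  exact (Multiset.filter_add_not _ _).symm

open Classical in
theorem outsideVerts_val_eq (h : ¬ G.Reachable u v) : (outsideVerts G u).val =
    (compVerts G v).val + (outsideVerts G u ∩ outsideVerts G v).val := by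
  have hd : Disjoint (compVerts G v) (outsideVerts G u ∩ outsideVerts G v) := by
    rw [Finset.disjoint_left]
    intro t h1 h2
    simp only [mem_compVerts, Finset.mem_inter, mem_outsideVerts] at h1 h2
    exact h2.2 h1
  have : outsideVerts G u = (compVerts G v).disjUnion _ hd := by
    ext t
    simp only [Finset.mem_disjUnion, mem_compVerts, Finset.mem_inter, mem_outsideVerts]
    constructor
    · intro ht
      by_cases hv : G.Reachable v t
      exacts [.inl hv, .inr ⟨ht, hv⟩]
    · rintro (hv | ht)
      exacts [fun hu => h (hu.trans hv.symm), ht.1]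
  rw [← Finset.disjUnion_val _ _ hd, ← this]

namespace SparseBisim

theorem comp_diag_map (h : SparseBisim G G' c c' τ) (e : c u u = c' u' u') :
    ((compVerts G u).val.map fun t => c t t) = (compVerts G' u').val.map fun t => c' t t :=
  Multiset.map_congr_of_map_eq (h.comp e) fun _ ht _ ht' e' =>
    h.right (mem_compVerts.1 ht) (mem_compVerts.1 ht') e'

theorem outside_diag_map (h : SparseBisim G G' c c' τ)
    (hD : ((Finset.univ : Finset V).val.map fun u => c u u) =
      (Finset.univ : Finset V').val.map fun u => c' u u) (e : c u u = c' u' u') :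
    ((outsideVerts G u).val.map fun t => c t t) = (outsideVerts G' u').val.map fun t => c' t t := by
  rw [univ_val_eq G u, univ_val_eq G' u', Multiset.map_add, Multiset.map_add,
    h.comp_diag_map e] at hD
  exact Multiset.add_right_inj.1 hD

/-- The chain colors are stable under full 2-FWL refinement. -/
theorem chainColor_stable (h : SparseBisim G G' c c' τ)
    (hD : ((Finset.univ : Finset V).val.map fun u => c u u) =
      (Finset.univ : Finset V').val.map fun u => c' u u)
    (e : chainColor G c u v = chainColor G' c' u' v') :
    ((Finset.univ : Finset V).val.map fun t => (chainColor G c u t, chainColor G c t v)) =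
      (Finset.univ : Finset V').val.map fun t =>
        (chainColor G' c' u' t, chainColor G' c' t v') := by
  classical
  have eu : c u u = c' u' u' := congrArg Prod.fst e
  have ev : c v v = c' v' v' := congrArg (fun x => x.2.1) e
  have hiff := reachable_iff_of_chainColor_eq e
  rw [univ_val_eq G u, univ_val_eq G' u', Multiset.map_add, Multiset.map_add]
  by_cases hr : G.Reachable u v
  · have hr' := hiff.1 hr
    have el := colorChain_eq_of_chainColor_eq e hr
    congr 1
    · refine Multiset.map_congr_of_map_eq (h.pair_map hr hr' eu el) fun t ht t' ht' et => ?_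
      have ht := mem_compVerts.1 ht
      have ht' := mem_compVerts.1 ht'
      have et1 := congrArg Prod.fst et
      have et2 := congrArg Prod.snd et
      simp only at et1 et2
      rw [chainColor_of_reachable ht, chainColor_of_reachable ht',
        chainColor_of_reachable (ht.symm.trans hr), chainColor_of_reachable (ht'.symm.trans hr'),
        eu, ev, et1, et2, h.end_eq ht ht' eu et1]
    -- For `t` outside the component both pairs are disconnected, so only the colour of `t` matters.
    · refine Multiset.map_congr_of_map_eq (h.outside_diag_map hD eu) fun t ht t' ht' et => ?_
      have ht := mem_outsideVerts.1 ht
      have ht' := mem_outsideVerts.1 ht'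
      rw [chainColor_of_not_reachable ht, chainColor_of_not_reachable ht',
        chainColor_of_not_reachable fun hh => ht (hr.trans hh.symm),
        chainColor_of_not_reachable fun hh => ht' (hr'.trans hh.symm), eu, ev, et]
  · have hr' := fun hh => hr (hiff.2 hh)
    congr 1
    · refine Multiset.map_congr_of_map_eq (h.comp_map eu) fun t ht t' ht' et => ?_
      have ht := mem_compVerts.1 ht
      have ht' := mem_compVerts.1 ht'
      rw [chainColor_of_reachable ht, chainColor_of_reachable ht',
        chainColor_of_not_reachable fun hh => hr (ht.trans hh),
        chainColor_of_not_reachable fun hh => hr' (ht'.trans hh),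
        eu, ev, et, h.end_eq ht ht' eu et]
    -- The remaining `t` lie in the component of `v` or in neither; the latter are found by
    -- cancelling diagonal colours.
    · have h3 := h.outside_diag_map hD eu
      rw [outsideVerts_val_eq hr, outsideVerts_val_eq hr', Multiset.map_add, Multiset.map_add] at h3 ⊢
      rw [h.comp_diag_map ev] at h3
      have h3 := Multiset.add_right_inj.1 h3
      congr 1
      · refine Multiset.map_congr_of_map_eq (h.comp_map ev) fun t ht t' ht' et => ?_
        have ht := mem_compVerts.1 ht
        have ht' := mem_compVerts.1 ht'
        rw [chainColor_of_not_reachable fun hh => hr (hh.trans ht.symm),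
          chainColor_of_not_reachable fun hh => hr' (hh.trans ht'.symm),
          chainColor_of_reachable ht.symm, chainColor_of_reachable ht'.symm,
          eu, ev, h.end_eq ht ht' ev et, colorChain_swap h.swap ht, colorChain_swap h.swap' ht', et]
      · refine Multiset.map_congr_of_map_eq h3 fun t ht t' ht' et => ?_
        have ht := Finset.mem_inter.1 ht
        have ht' := Finset.mem_inter.1 ht'
        rw [mem_outsideVerts, mem_outsideVerts] at ht ht'
        rw [chainColor_of_not_reachable ht.1, chainColor_of_not_reachable ht'.1,
          chainColor_of_not_reachable fun hh => ht.2 hh.symm,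
          chainColor_of_not_reachable fun hh => ht'.2 hh.symm, eu, ev, et]

theorem stdRep_eq (h : SparseBisim G G' c c' τ)
    (hD : ((Finset.univ : Finset V).val.map fun u => c u u) =
      (Finset.univ : Finset V').val.map fun u => c' u u)
    {I : Type} (M : MessagePassing I) {h₀ : V → V → I} {h₀' : V' → V' → I}
    (h0 : ∀ {u v u' v'}, chainColor G c u v = chainColor G' c' u' v' → h₀ u v = h₀' u' v')
    (l : ℕ) (e : chainColor G c u v = chainColor G' c' u' v') :
    M.stdRep h₀ l u v = M.stdRep h₀' l u' v' := by
  induction l generalizing u v u' v' with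
  | zero => exact h0 e
  | succ l ih =>
    refine congrArg₂ (M.Φ l) (ih e) (congrArg (M.agg l) ?_)
    refine Multiset.map_congr_of_map_eq (h.chainColor_stable hD e) fun t _ t' _ et => ?_
    rw [ih (congrArg Prod.fst et), ih (congrArg Prod.snd et)]

/-- Stability at `(u, u)` determines the colours of all pairs that start at `u`. -/
theorem pairs_map (h : SparseBisim G G' c c' τ)
    (hD : ((Finset.univ : Finset V).val.map fun u => c u u) =
      (Finset.univ : Finset V').val.map fun u => c' u u) :
    ((Finset.univ : Finset (V × V)).val.map fun p => chainColor G c p.1 p.2) =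
      (Finset.univ : Finset (V' × V')).val.map fun p => chainColor G' c' p.1 p.2 := by
  rw [← Finset.univ_product_univ, ← Finset.univ_product_univ, Finset.product_val,
    Finset.product_val]
  simp only [SProd.sprod, Multiset.product, Multiset.map_bind, Multiset.map_map, Function.comp_def]
  refine Multiset.bind_congr_of_map_eq hD fun u _ u' _ e => ?_
  refine Multiset.map_congr_of_map_eq (h.chainColor_stable hD (u := u) (v := u) (u' := u')
    (v' := u') ?_) fun t _ t' _ et => congrArg Prod.fst et
  rw [chainColor_of_reachable (.refl _), chainColor_of_reachable (.refl _), colorChain_self,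
    colorChain_self, e]

end SparseBisim

end ChainColor

/-! ### Chain colours determine the initial representation. -/

section InitialColors

variable {dx de K : ℕ} {X : Type} {G H : AttrGraph dx de} {c : G.V → G.V → X} {c' : H.V → H.V → X}
  {τ : X → X}

theorem rrwp_eq_zero_of_not_reachable {V : Type} [Fintype V] {G : SimpleGraph V} {u v : V}
    (h : ¬ G.Reachable u v) : rrwp G K u v = 0 := by
  classical
  funext k
  by_contra hne
  refine h ?_
  rw [SimpleGraph.reachable_iff_reflTransGen]
  exact Relation.ReflTransGen.mono (fun x y hxy => adj_of_randomWalk_ne_zero hxy) _ _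
    (Matrix.reflTransGen_of_pow_ne_zero hne)

/-- Node features come from the ends. Edge features vanish unless the pair is unseparated, and then
its colour is the whole chain. Random walk entries follow from `pow_eq`, and vanish between
components. -/
theorem SparseBisim.initRep_eq (h : SparseBisim G.graph H.graph c c' τ)
    (h0 : ∀ {u v u' v'}, G.graph.Reachable u v → H.graph.Reachable u' v' → c u v = c' u' v' →
      initRep K G u v = initRep K H u' v') {u v : G.V} {u' v' : H.V}
    (e : chainColor G.graph c u v = chainColor H.graph c' u' v') :
    initRep K G u v = initRep K H u' v' := by
  classical
  have eu : c u u = c' u' u' := congrArg Prod.fst e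
  have ev : c v v = c' v' v' := congrArg (fun x => x.2.1) e
  have hiff := reachable_iff_of_chainColor_eq e
  have xu : G.x u = H.x u' := congrArg Prod.fst (h0 (.refl _) (.refl _) eu)
  have xv : G.x v = H.x v' := congrArg Prod.fst (h0 (.refl _) (.refl _) ev)
  have hep : G.e u v = H.e u' v' ∧ rrwp G.graph K u v = rrwp H.graph K u' v' := by
    by_cases hr : G.graph.Reachable u v
    · have hr' := hiff.1 hr
      have el := colorChain_eq_of_chainColor_eq e hr
      constructor
      · by_cases hu : G.graph.Unsep u v
        · have := (SparseBisim.eq_of_unsep hr hr' el hu).1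
          exact congrArg (fun x => x.2.2.1) (h0 hr hr' this)
        · have hu' := fun hh => hu (SparseBisim.eq_of_unsep hr' hr el.symm hh).2
          rw [G.e_zero u v fun hh => hu (.of_adj hh), H.e_zero u' v' fun hh => hu' (.of_adj hh)]
      · funext k
        refine h.pow_eq (fun x y => adj_of_randomWalk_ne_zero)
          (fun x y => adj_of_randomWalk_ne_zero) (n := K) (fun hr hr' e k hk => ?_) hr hr' eu el
          k k.2
        exact congrArg (fun x => x.2.2.2 ⟨k, hk⟩) (h0 hr hr' e)
    · have hr' := fun hh => hr (hiff.2 hh)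
      rw [rrwp_eq_zero_of_not_reachable hr, rrwp_eq_zero_of_not_reachable hr',
        G.e_zero u v fun hh => hr hh.reachable, H.e_zero u' v' fun hh => hr' hh.reachable]
      exact ⟨rfl, rfl⟩
  rw [initRep, initRep, xu, xv, hep.1, hep.2]

theorem SparseBisim.standard_out_eq (h : SparseBisim G.graph H.graph c c' τ)
    (hD : ((Finset.univ : Finset G.V).val.map fun u => c u u) =
      (Finset.univ : Finset H.V).val.map fun u => c' u u)
    (h0 : ∀ {u v u' v'}, G.graph.Reachable u v → H.graph.Reachable u' v' → c u v = c' u' v' →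
      initRep K G u v = initRep K H u' v') (M : StandardGNN dx de K) : M.out G = M.out H := by
  refine congrArg M.Ψ (congrArg M.readAgg ?_)
  exact Multiset.map_congr_of_map_eq (h.pairs_map hD) fun p _ p' _ e =>
    h.stdRep_eq hD _ (h.initRep_eq h0) _ e

end InitialColors

/-! ### The universal co-sparsified model dominates all standard ones. -/

section SparseColors

namespace SimpleGraph

variable {V : Type} {G : SimpleGraph V} {u v : V}

theorem spInteraction_left (h : G.Reachable u v) : SpInteraction G u u v := by
  by_cases hne : u = v
  · exact ⟨h, .inl ⟨hne, .refl _⟩⟩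
  · exact ⟨h, .inr ⟨hne, .inl rfl⟩⟩

theorem spInteraction_right (h : G.Reachable u v) : SpInteraction G u v v := by
  by_cases hne : u = v
  · exact ⟨h, .inl ⟨hne, h⟩⟩
  · exact ⟨h, .inr ⟨hne, .inr (.inl rfl)⟩⟩

variable [Fintype V]

theorem spNbr_self (G : SimpleGraph V) (u : V) : spNbr G u u = compVerts G u := by
  ext t
  rw [mem_spNbr, spInteraction_iff, mem_compVerts]
  simp

theorem spNbr_comm (G : SimpleGraph V) (u v : V) : spNbr G u v = spNbr G v u := by
  ext t
  rw [mem_spNbr, mem_spNbr]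
  exact ⟨.symm, .symm⟩

/-- Rephrases separation through data that sparse message passing sees: adjacency and the presence
of a 3-node interaction. -/
theorem unsep_iff_adj_or (h : G.Reachable u v) : G.Unsep u v ↔
    G.Adj u v ∨ (u ≠ v ∧ ∃ t ∈ spNbr G u v, t ≠ u ∧ t ≠ v) := by
  constructor
  · intro hu
    by_cases ha : G.Adj u v
    · exact .inl ha
    · obtain ⟨t, h1, h2⟩ := hu.exists_of_not_adj ha
      refine .inr ⟨hu.ne, t, ?_, h1.ne.symm, h2.ne⟩
      rw [mem_spNbr, spInteraction_iff]
      exact ⟨h, .inr ⟨hu.ne, .inr (.inr ⟨h1, h2, hu⟩)⟩⟩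
  · rintro (ha | ⟨hne, t, ht, htu, htv⟩)
    · exact .of_adj ha
    · rw [mem_spNbr, spInteraction_iff] at ht
      rcases ht with ⟨-, ⟨h1, -⟩ | ⟨-, h1 | h1 | h1⟩⟩
      exacts [absurd h1 hne, absurd h1 htu, absurd h1 htv, h1.2.2]

open Classical in
theorem Unsep.commonVerts_eq (h : G.Unsep u v) :
    commonVerts G u v = (spNbr G u v).filter fun t => t ≠ u ∧ t ≠ v := by
  ext t
  rw [mem_commonVerts, Finset.mem_filter, mem_spNbr, spInteraction_iff]
  constructor
  · rintro ⟨h1, h2⟩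
    exact ⟨⟨h.reachable, .inr ⟨h.ne, .inr (.inr ⟨h1, h2, h⟩)⟩⟩, h1.ne.symm, h2.ne⟩
  · rintro ⟨⟨-, ⟨h1, -⟩ | ⟨-, h1 | h1 | h1⟩⟩, h2, h3⟩
    exacts [absurd h1 h.ne, absurd h1 h2, absurd h1 h3, ⟨h1.1, h1.2.1⟩]

end SimpleGraph

/-- Equality of the colors `r` and `r'` of pairs within components respects diagonal and adjacency,
and is stable under co-sparsified refinement. -/
structure SpStable {V V' X : Type} [Fintype V] [Fintype V'] (G : SimpleGraph V)
    (G' : SimpleGraph V') (r : V → V → X) (r' : V' → V' → X) : Prop where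
  diag : ∀ {u v u' v'}, G.Reachable u v → G'.Reachable u' v' → r u v = r' u' v' →
    (u = v ↔ u' = v')
  adj : ∀ {u v u' v'}, G.Reachable u v → G'.Reachable u' v' → r u v = r' u' v' →
    (G.Adj u v ↔ G'.Adj u' v')
  stable : ∀ {u v u' v'}, G.Reachable u v → G'.Reachable u' v' → r u v = r' u' v' →
    ((spNbr G u v).val.map fun t => (r u t, r t v)) =
      (spNbr G' u' v').val.map fun t => (r' u' t, r' t v')

namespace SpStable

variable {V V' X : Type} [Fintype V] [Fintype V'] {G : SimpleGraph V}
    {G' : SimpleGraph V'} {r : V → V → X} {r' : V' → V' → X} {u v : V} {u' v' : V'}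

theorem symm (h : SpStable G G' r r') : SpStable G' G r' r where
  diag hr hr' e := (h.diag hr' hr e.symm).symm
  adj hr hr' e := (h.adj hr' hr e.symm).symm
  stable hr hr' e := (h.stable hr' hr e.symm).symm

theorem left (h : SpStable G G' r r') (hr : G.Reachable u v) (hr' : G'.Reachable u' v')
    (e : r u v = r' u' v') : r u u = r' u' u' := by
  obtain ⟨t', ht', e'⟩ := Multiset.exists_of_map_eq (h.stable hr hr' e)
    (mem_spNbr.2 (SimpleGraph.spInteraction_left hr))
  have e1 : r u u = r' u' t' := congrArg Prod.fst e'
  obtain rfl := (h.diag (.refl _) (mem_spNbr.1 ht').reachable_left e1).1 rfl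
  exact e1

theorem right (h : SpStable G G' r r') (hr : G.Reachable u v) (hr' : G'.Reachable u' v')
    (e : r u v = r' u' v') : r v v = r' v' v' := by
  obtain ⟨t', ht', e'⟩ := Multiset.exists_of_map_eq (h.stable hr hr' e)
    (mem_spNbr.2 (SimpleGraph.spInteraction_right hr))
  have e1 : r v v = r' t' v' := congrArg Prod.snd e'
  obtain rfl := (h.diag (.refl _) (mem_spNbr.1 ht').reachable_right e1).1 rfl
  exact e1

-- A self-pair aggregates over its whole component, which contains all neighbours.
open Classical in
theorem degree_eq (h : SpStable G G' r r') (e : r u u = r' u' u') :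
    G.degree u = G'.degree u' := by
  have key : ∀ {W : Type} [Fintype W] (F : SimpleGraph W) (u : W),
      F.degree u = ((spNbr F u u).val.filter fun t => F.Adj u t).card := by
    intro W _ F u
    rw [← Finset.filter_val, Finset.card_val, ← SimpleGraph.card_neighborFinset_eq_degree]
    congr 1
    ext t
    rw [SimpleGraph.mem_neighborFinset, Finset.mem_filter, SimpleGraph.spNbr_self, mem_compVerts]
    exact ⟨fun h => ⟨h.reachable, h⟩, And.right⟩
  rw [key, key]
  have := congrArg Multiset.card (Multiset.filter_map_congr_of_map_eq
    (h.stable (.refl _) (.refl _) e) (p := fun t => G.Adj u t) (p' := fun t => G'.Adj u' t)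
    fun t ht t' ht' e' => h.adj (mem_spNbr.1 ht).reachable_left (mem_spNbr.1 ht').reachable_left
      (congrArg Prod.fst e'))
  simpa only [Multiset.card_map] using this

theorem unsep (h : SpStable G G' r r') (hr : G.Reachable u v) (hr' : G'.Reachable u' v')
    (e : r u v = r' u' v') (hu : G.Unsep u v) : G'.Unsep u' v' := by
  rw [SimpleGraph.unsep_iff_adj_or hr] at hu
  rw [SimpleGraph.unsep_iff_adj_or hr']
  refine hu.imp (h.adj hr hr' e).1 ?_
  rintro ⟨hne, t, ht, htu, htv⟩
  refine ⟨fun hh => hne ((h.diag hr hr' e).2 hh), ?_⟩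
  obtain ⟨t', ht', et⟩ := Multiset.exists_of_map_eq (h.stable hr hr' e) ht
  refine ⟨t', ht', fun hh => htu ?_, fun hh => htv ?_⟩
  · exact ((h.diag (mem_spNbr.1 ht).reachable_left (mem_spNbr.1 ht').reachable_left
      (congrArg Prod.fst et)).2 hh.symm).symm
  · exact (h.diag (mem_spNbr.1 ht).reachable_right (mem_spNbr.1 ht').reachable_right
      (congrArg Prod.snd et)).2 hh

/-- If the colors of a pair determine those of the reversed pair, pairs of colors in both
directions form a `SparseBisim`. -/
theorem sparseBisim (h : SpStable G G' r r')
    (hswap : ∀ {u v u' v'}, G.Reachable u v → G'.Reachable u' v' → r u v = r' u' v' →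
      r v u = r' v' u') :
    SparseBisim G G' (fun u v => (r u v, r v u)) (fun u v => (r' u v, r' v u)) Prod.swap where
  swap _ _ := rfl
  swap' _ _ := rfl
  left hr hr' e := by
    have := h.left hr hr' (congrArg Prod.fst e)
    exact Prod.ext this this
  unsep hr hr' e :=
    ⟨h.unsep hr hr' (congrArg Prod.fst e), h.symm.unsep hr' hr (congrArg Prod.fst e).symm⟩
  comp {u u'} e := by
    have := h.stable (.refl _) (.refl _) (congrArg Prod.fst e)
    rwa [SimpleGraph.spNbr_self, SimpleGraph.spNbr_self] at this
  common {u v u' v'} hu hu' e := by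
    classical
    rw [hu.commonVerts_eq, hu'.commonVerts_eq, Finset.filter_val, Finset.filter_val]
    refine Multiset.map_congr_of_map_eq (Multiset.filter_map_congr_of_map_eq
      (h.stable hu.reachable hu'.reachable (congrArg Prod.fst e)) fun t ht t' ht' et => ?_)
      fun t ht t' ht' et => ?_
    · have e1 := h.diag (mem_spNbr.1 ht).reachable_left (mem_spNbr.1 ht').reachable_left
        (congrArg Prod.fst et)
      have e2 := h.diag (mem_spNbr.1 ht).reachable_right (mem_spNbr.1 ht').reachable_right
        (congrArg Prod.snd et)
      rw [ne_eq, ne_eq, ne_eq, ne_eq, e2, eq_comm, e1, eq_comm (a := u')]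
    · have ht := mem_spNbr.1 (Multiset.mem_of_mem_filter ht)
      have ht' := mem_spNbr.1 (Multiset.mem_of_mem_filter ht')
      have e1 : r u t = r' u' t' := congrArg Prod.fst et
      have e2 : r t v = r' t' v' := congrArg Prod.snd et
      rw [e1, e2, hswap ht.reachable_left ht'.reachable_left e1,
        hswap ht.reachable_right ht'.reachable_right e2]

end SpStable

variable {dx de K : ℕ} {X : Type} {G H : AttrGraph dx de} {r : G.V → G.V → X} {r' : H.V → H.V → X}

/-- Only the initial random walk entries are asymmetric in more than order; reversibility handles
them, as stable colours determine degrees. Later layers follow from the symmetry of the neighbour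
sets. -/
theorem SpStable.spRep_swap (h : SpStable G.graph H.graph r r')
    (h0 : ∀ {u v u' v'}, G.graph.Reachable u v → H.graph.Reachable u' v' → r u v = r' u' v' →
      initRep K G u v = initRep K H u' v') (M : MessagePassing (InitRep dx de K)) (l : ℕ)
    {u v : G.V} {u' v' : H.V} (hr : G.graph.Reachable u v) (hr' : H.graph.Reachable u' v')
    (e : r u v = r' u' v') :
    M.spRep G.graph (initRep K G) l v u = M.spRep H.graph (initRep K H) l v' u' := by
  classical
  induction l generalizing u v u' v' with
  | zero =>
    show initRep K G v u = initRep K H v' u'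
    have hi := h0 hr hr' e
    by_cases huv : u = v
    · obtain rfl := (h.diag hr hr' e).1 huv
      subst huv
      exact hi
    have e1 : G.x u = H.x u' := congrArg Prod.fst hi
    have e2 : G.x v = H.x v' := congrArg (fun x => x.2.1) hi
    have e3 : G.e u v = H.e u' v' := congrArg (fun x => x.2.2.1) hi
    rw [initRep, initRep, e1, e2, G.e_symm, H.e_symm, e3]
    congr 3
    funext k
    refine randomWalk_pow_symm_congr (h.degree_eq (h.left hr hr' e))
      (h.degree_eq (h.right hr hr' e)) ?_ (congrArg (fun x => x.2.2.2 k) hi)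
    -- A node connected to a different one has positive degree.
    obtain ⟨w, hw⟩ := hr.symm.exists_isPath
    cases w with
    | nil => exact absurd rfl huv
    | cons ha _ => exact ((G.graph.degree_pos_iff_exists_adj v).2 ⟨_, ha⟩).ne'
  | succ l ih =>
    rw [MessagePassing.spRep_succ_of_reachable hr.symm,
      MessagePassing.spRep_succ_of_reachable hr'.symm, ih hr hr' e]
    congr 2
    rw [SimpleGraph.spNbr_comm, SimpleGraph.spNbr_comm H.graph]
    refine Multiset.map_congr_of_map_eq (h.stable hr hr' e) fun t ht t' ht' et => ?_
    have ht := mem_spNbr.1 ht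
    have ht' := mem_spNbr.1 ht'
    rw [ih ht.reachable_left ht'.reachable_left (congrArg Prod.fst et),
      ih ht.reachable_right ht'.reachable_right (congrArg Prod.snd et)]

open Classical in
theorem univ_val_eq_bind_component {V : Type} [Fintype V] (G : SimpleGraph V) :
    (Finset.univ : Finset V).val = (Finset.univ.image G.connectedComponentMk).val.bind fun C =>
      ((Finset.univ : Finset V).filter fun u => u ∈ C.supp).val := by
  have hd : ((Finset.univ.image G.connectedComponentMk : Finset _) :
      Set G.ConnectedComponent).PairwiseDisjoint
        fun C => (Finset.univ : Finset V).filter fun u => u ∈ C.supp := by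
    intro C _ C' _ hne
    rw [Function.onFun, Finset.disjoint_left]
    intro t h1 h2
    exact hne ((Finset.mem_filter.1 h1).2.symm.trans (Finset.mem_filter.1 h2).2)
  rw [← Finset.disjiUnion_val _ _ hd]
  congr 1
  symm
  rw [Finset.eq_univ_iff_forall]
  intro t
  rw [Finset.mem_disjiUnion]
  exact ⟨_, Finset.mem_image_of_mem _ (Finset.mem_univ t),
    Finset.mem_filter.2 ⟨Finset.mem_univ t, rfl⟩⟩

/-- The self-pair readout alone suffices, since diagonal colours determine everything else. The
disjoint ranges of `compOut` and `Ψ` exclude the case that only one graph is connected. -/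
theorem CoSparsifiedGNN.diag_map_eq_of_out_eq {U : CoSparsifiedGNN dx de K}
    (hc : Function.Injective2 U.compOut) (hΨ : Function.Injective U.Ψ)
    (hne : ∀ a b y, U.compOut a b ≠ U.Ψ y) (hout : U.out G = U.out H) :
    ((Finset.univ : Finset G.V).val.map fun u => U.spRep G.graph (initRep K G) U.depth u u) =
      (Finset.univ : Finset H.V).val.map fun u => U.spRep H.graph (initRep K H) U.depth u u := by
  classical
  unfold CoSparsifiedGNN.out at hout
  by_cases hG : G.graph.Connected <;> by_cases hH : H.graph.Connected
  · rw [dif_pos hG, dif_pos hH] at hout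
    have h1 := U.pairAgg_injective (hc hout).1
    have key : ∀ {F : AttrGraph dx de} (hF : F.graph.Connected) (u : F.V),
        ((Finset.univ : Finset F.V).filter
          fun t => t ∈ (F.graph.connectedComponentMk u).supp) = Finset.univ := by
      intro F hF u
      rw [Finset.filter_eq_self]
      intro t _
      exact SimpleGraph.ConnectedComponent.sound (hF.preconnected _ _)
    rwa [key hG, key hH] at h1
  · rw [dif_pos hG, dif_neg hH] at hout
    exact absurd hout (hne _ _ _)
  · rw [dif_neg hG, dif_pos hH] at hout
    exact absurd hout.symm (hne _ _ _)
  · rw [dif_neg hG, dif_neg hH] at hout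
    rw [univ_val_eq_bind_component G.graph, univ_val_eq_bind_component H.graph, Multiset.map_bind,
      Multiset.map_bind]
    exact Multiset.bind_congr_of_map_eq (U.compAgg_injective (hΨ hout)) fun C _ C' _ e =>
      U.pairAgg_injective (hc e).1

/-- Some co-sparsified model separates all graphs of the class that any standard one separates. -/
theorem exists_coSparsifiedGNN_dominating (𝒢 : Set (AttrGraph dx de)) (N : ℕ)
    (hN : ∀ G ∈ 𝒢, Fintype.card G.V ≤ N) (hinit : ConsistentInit K 𝒢) :
    ∃ U : CoSparsifiedGNN dx de K, ∀ G ∈ 𝒢, ∀ H ∈ 𝒢, U.out G = U.out H →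
      ∀ M : StandardGNN dx de K, M.out G = M.out H := by
  obtain ⟨U, hL, hU, hc, hΨ, hne⟩ :=
    CoSparsifiedGNN.exists_isInjective dx de K (N * N * (N * N))
  refine ⟨U, fun G hG H hH hout M => ?_⟩
  have hcard : Fintype.card (G.V × G.V) * Fintype.card (H.V × H.V) ≤ U.depth := by
    rw [hL, Fintype.card_prod, Fintype.card_prod]
    have := hN G hG
    have := hN H hH
    gcongr
  have h0 : ∀ {u v : G.V} {u' v' : H.V}, G.graph.Reachable u v → H.graph.Reachable u' v' →
      U.spRep G.graph (initRep K G) U.depth u v = U.spRep H.graph (initRep K H) U.depth u' v' →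
      initRep K G u v = initRep K H u' v' := fun hr hr' e => hU.spRep_zero_of_eq hr hr' e
  have hS : SpStable G.graph H.graph (U.spRep G.graph (initRep K G) U.depth)
      (U.spRep H.graph (initRep K H) U.depth) :=
    { diag := fun hr hr' e => (hinit G hG H hH _ _ _ _ (h0 hr hr' e)).1
      adj := fun hr hr' e => (hinit G hG H hH _ _ _ _ (h0 hr hr' e)).2
      stable := fun hr hr' e => hU.spRep_stable hcard hr hr' e }
  -- Recording both directions of a pair makes colour reversal a fixed map, namely `Prod.swap`.
  have hB := hS.sparseBisim fun hr hr' e => hS.spRep_swap h0 _ _ hr hr' e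
  refine hB.standard_out_eq (Multiset.map_congr_of_map_eq
    (CoSparsifiedGNN.diag_map_eq_of_out_eq hc hΨ hne hout) fun u _ u' _ e => ?_)
    (fun hr hr' e => h0 hr hr' (congrArg Prod.fst e)) M
  exact Prod.ext e e

end SparseColors

theorem theorem1 {dx de K : ℕ} (𝒢 : Set (AttrGraph dx de)) (N : ℕ)
    (hN : ∀ G ∈ 𝒢, Fintype.card G.V ≤ N) (hinit : ConsistentInit K 𝒢) :
    (∀ (W : Type) [Finite W] (Q : SimpleGraph W),
      (∃ M : CoSparsifiedGNN dx de K, Detects M.out Q 𝒢) ↔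
        ∃ M : StandardGNN dx de K, Detects M.out Q 𝒢) ∧
    ∀ G ∈ 𝒢, ∀ H ∈ 𝒢,
      (∃ M : CoSparsifiedGNN dx de K, M.out G ≠ M.out H) ↔
        ∃ M : StandardGNN dx de K, M.out G ≠ M.out H := by
  -- One model of each kind serves for every `Q` and every pair of graphs.
  obtain ⟨S, hS⟩ := exists_standardGNN_dominating 𝒢 N hN hinit
  obtain ⟨C, hC⟩ := exists_coSparsifiedGNN_dominating 𝒢 N hN hinit
  refine ⟨fun W _ Q => ⟨?_, ?_⟩, fun G hG H hH => ⟨?_, ?_⟩⟩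
  · rintro ⟨M, hM⟩
    exact ⟨S, fun G hG H hH h h' e => hM G hG H hH h h' (hS G hG H hH e M)⟩
  · rintro ⟨M, hM⟩
    exact ⟨C, fun G hG H hH h h' e => hM G hG H hH h h' (hC G hG H hH e M)⟩
  · rintro ⟨M, hM⟩
    exact ⟨S, fun e => hM (hS G hG H hH e M)⟩
  · rintro ⟨M, hM⟩
    exact ⟨C, fun e => hM (hC G hG H hH e M)⟩
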